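/- Let $U,V,X,Y,Z$ be random variables on a common probability space, each taking values in a finite alphabet, such that the alphabet of $X$ has exactly two elements and $(U,V)\to X\to (Y,Z)$ is a Markov chain, i.e. $(U,V)$ and $(Y,Z)$ are conditionally independent given $X$. Then $$I(U;Y)+I(V;Z)-I(U;V)\;\le\;\max\{I(X;Y),\,I(X;Z)\},$$ where, for random variables $S,T$ with finite alphabets, $I(S;T)=\sum_{s,t}P(S=s,T=t)\log\frac{P(S=s,T=t)}{P(S=s)P(T=t)}$ denotes mutual information (terms with $P(S=s,T=t)=0$ are $0$). In particular, the inequality holds for every broadcast channel $p(y,z|x)$ with binary input alphabet and finite output alphabets. -/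

import Mathlib

open MeasureTheory

namespace InfoIneq

/-- The probability mass function of a random variable `X` at `x`: `P(X = x)`. -/
noncomputable def prob {Ω A : Type*} [MeasurableSpace Ω] (μ : Measure Ω) (X : Ω → A) (x : A) : ℝ :=
  μ.real (X ⁻¹' {x})

/-- Mutual information (in nats) of two random variables with finite alphabets,
`I(X;Y) = ∑ P(X = x, Y = y) log (P(X = x, Y = y) / (P(X = x) P(Y = y)))`.
Terms with `P(X = x, Y = y) = 0` are equal to `0`, which is the usual convention; in all other
terms the denominator is positive. -/
noncomputable def mutualInfo {Ω A B : Type*} [MeasurableSpace Ω] [Fintype A] [Fintype B]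
    (μ : Measure Ω) (X : Ω → A) (Y : Ω → B) : ℝ :=
  ∑ x : A, ∑ y : B, prob μ (fun ω => (X ω, Y ω)) (x, y) *
    Real.log (prob μ (fun ω => (X ω, Y ω)) (x, y) / (prob μ X x * prob μ Y y))

/-- `S → X → T` is a Markov chain: `S` and `T` are conditionally independent given `X`, that is
`P(S = s, X = x, T = t) P(X = x) = P(S = s, X = x) P(X = x, T = t)` for all `s`, `x`, `t`. -/
def IsMarkovChain {Ω A B C : Type*} [MeasurableSpace Ω]
    (μ : Measure Ω) (S : Ω → A) (X : Ω → B) (T : Ω → C) : Prop :=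
  ∀ (s : A) (x : B) (t : C),
    prob μ (fun ω => (S ω, X ω, T ω)) (s, x, t) * prob μ X x =
      prob μ (fun ω => (S ω, X ω)) (s, x) * prob μ (fun ω => (X ω, T ω)) (x, t)

end InfoIneq

/-! ### Entropy form of the two sides -/

namespace InfoIneq
open Real Finset

/-! Subtract `H(Y) + H(Z)` from both sides: the left becomes `H(U,V) - H(U,Y) - H(V,Z)`
(`auxValue`), and the right becomes `inputBound`.

The problem reduces to binary `U`, `V` with `X` a function of them. By the functional
representation, `X = F(U,V)` for a random function `F` independent of `(U,V)`. Replacing `V` by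
`(V,F)` adds `H(F)` to `H(U,V)` and at most `H(F)` to `H(V,Z)`, so `auxValue` does not decrease
(`auxValue_le_inputBound`). With the law of `(V,X)` given `U = u` fixed, `auxValue` is convex in the
weights of the values `u`. Moving the weights along relations that preserve the two masses of `X`
leaves at most two values of `U`, and `X` is still a function of `(U,V)` (`exists_binary_fst`). The
same is then done to `V`.

Up to relabelling, a Boolean function of two bits is constant, a projection, an exclusive or, or a
conjunction. The last three cases use a certificate that does not depend on the channels
(`auxValue_le_of_dominates`): for some `η` in `[0,1]`, `η H(X) - H(U)` and `(1-η) H(X) - H(V)` lie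
below linear functions of the law of `X`. Averaging over `Y` and over `Z` bounds `auxValue` by the
`η`-mixture of the two terms of the maximum. For a projection, `η` is `0` or `1`. For the exclusive
or, the linear functions are tangents to the concave functions of `concaveOn_entropy_gap`. For the
conjunction, `X → U` and `X → V` are Z-channels, and the lines touch at a reference input under
which `U` and `V` are independent (`entropy_gap_ge_of_log_eq`). -/

/-- `H(U,V) - H(U,Y) - H(V,Z)` for a joint law `w` of `(U,V,X)` and channels `Wy`, `Wz`. -/
noncomputable def auxValue {U V Y Z : Type*} [Fintype U] [Fintype V] [Fintype Y] [Fintype Z]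
    (Wy : Bool → Y → ℝ) (Wz : Bool → Z → ℝ) (w : U → V → Bool → ℝ) : ℝ :=
  (∑ u, ∑ v, negMulLog (∑ x, w u v x))
    - (∑ u, ∑ y, negMulLog (∑ x, (∑ v, w u v x) * Wy x y))
    - (∑ v, ∑ z, negMulLog (∑ x, (∑ u, w u v x) * Wz x z))

/-- `max {I(X;Y), I(X;Z)} - H(Y) - H(Z)` for the input law `p`. -/
noncomputable def inputBound {Y Z : Type*} [Fintype Y] [Fintype Z]
    (Wy : Bool → Y → ℝ) (Wz : Bool → Z → ℝ) (p : Bool → ℝ) : ℝ :=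
  max ((∑ x, negMulLog (p x)) - (∑ x, ∑ y, negMulLog (p x * Wy x y))
      - ∑ z, negMulLog (∑ x, p x * Wz x z))
    ((∑ x, negMulLog (p x)) - (∑ x, ∑ z, negMulLog (p x * Wz x z))
      - ∑ y, negMulLog (∑ x, p x * Wy x y))

/-! ### Channel-independent linear certificates -/

section Certificate
variable {U V Y Z : Type*} [Fintype U] [Fintype V] [Fintype Y] [Fintype Z]

/-- `η H(X) - H(U)` is dominated by the linear function `A` of the law of `X`, the conditional law
of `U` given `X` being `α`; stated for unnormalized laws. -/
def Dominates (η : ℝ) (α : Bool → U → ℝ) (A : Bool → ℝ) : Prop :=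
  ∀ a : Bool → ℝ, (∀ x, 0 ≤ a x) →
    η * ((∑ x, negMulLog (a x)) - negMulLog (∑ x, a x))
      - ((∑ u, negMulLog (∑ x, a x * α x u)) - negMulLog (∑ x, a x)) ≤ ∑ x, A x * a x

/-- Domination at the unnormalized posteriors `p x * Wy x y`, summed over `y`, reads `η H(X|Y) -
H(U|Y) ≤ E[A(X)]`. The right side is free of the channel because `A` acts linearly. -/
lemma Dominates.sum_le {η : ℝ} {α : Bool → U → ℝ} {A : Bool → ℝ} (h : Dominates η α A)
    {Wy : Bool → Y → ℝ} (hW : ∀ x y, 0 ≤ Wy x y) (hW1 : ∀ x, ∑ y, Wy x y = 1)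
    {p : Bool → ℝ} (hp : ∀ x, 0 ≤ p x) :
    η * ((∑ x, ∑ y, negMulLog (p x * Wy x y)) - ∑ y, negMulLog (∑ x, p x * Wy x y))
      - ((∑ u, ∑ y, negMulLog (∑ x, (p x * α x u) * Wy x y))
        - ∑ y, negMulLog (∑ x, p x * Wy x y)) ≤ ∑ x, A x * p x := by
  have key := Finset.sum_le_sum (s := Finset.univ) fun y _ =>
    h (fun x => p x * Wy x y) fun x => mul_nonneg (hp x) (hW x y)
  have e : ∑ y, ∑ x, A x * (p x * Wy x y) = ∑ x, A x * p x := by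
    rw [Finset.sum_comm]
    refine Finset.sum_congr rfl fun x _ => ?_
    simp_rw [← mul_assoc]
    rw [← Finset.mul_sum, hW1, mul_one]
  rw [e] at key
  refine le_trans (le_of_eq ?_) key
  rw [Finset.sum_sub_distrib, ← Finset.mul_sum, Finset.sum_sub_distrib, Finset.sum_sub_distrib,
    Finset.sum_comm (s := (univ : Finset Bool)), Finset.sum_comm (s := (univ : Finset U))]
  simp_rw [mul_right_comm]

/-- `auxValue` is `H(U,V) - H(U|Y) - H(V|Z) - H(Y) - H(Z)`. The two dominations bound the
conditional entropies, and `hsum` leaves `η I(X;Y) + (1-η) I(X;Z) - H(Y) - H(Z)`, a mixture that is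
at most the maximum. -/
lemma auxValue_le_of_dominates {Wy : Bool → Y → ℝ} {Wz : Bool → Z → ℝ}
    (hWy : ∀ x y, 0 ≤ Wy x y) (hWy1 : ∀ x, ∑ y, Wy x y = 1)
    (hWz : ∀ x z, 0 ≤ Wz x z) (hWz1 : ∀ x, ∑ z, Wz x z = 1)
    {w : U → V → Bool → ℝ} {p : Bool → ℝ} (hp : ∀ x, 0 ≤ p x)
    {η : ℝ} (h0 : 0 ≤ η) (h1 : η ≤ 1) {α : Bool → U → ℝ} {β : Bool → V → ℝ} {A B : Bool → ℝ}
    (hα : ∀ u x, ∑ v, w u v x = p x * α x u) (hβ : ∀ v x, ∑ u, w u v x = p x * β x v)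
    (hA : Dominates η α A) (hB : Dominates (1 - η) β B)
    (hsum : (∑ u, ∑ v, negMulLog (∑ x, w u v x)) + ∑ x, (A x + B x) * p x
      ≤ ∑ x, negMulLog (p x)) :
    auxValue Wy Wz w ≤ inputBound Wy Wz p := by
  have e1 := hA.sum_le hWy hWy1 hp
  have e2 := hB.sum_le hWz hWz1 hp
  simp only [add_mul, Finset.sum_add_distrib] at hsum
  unfold auxValue inputBound
  simp only [hα, hβ]
  have m1 := mul_le_mul_of_nonneg_left (le_max_left
    ((∑ x, negMulLog (p x)) - (∑ x, ∑ y, negMulLog (p x * Wy x y))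
      - ∑ z, negMulLog (∑ x, p x * Wz x z))
    ((∑ x, negMulLog (p x)) - (∑ x, ∑ z, negMulLog (p x * Wz x z))
      - ∑ y, negMulLog (∑ x, p x * Wy x y))) h0
  have m2 := mul_le_mul_of_nonneg_left (le_max_right
    ((∑ x, negMulLog (p x)) - (∑ x, ∑ y, negMulLog (p x * Wy x y))
      - ∑ z, negMulLog (∑ x, p x * Wz x z))
    ((∑ x, negMulLog (p x)) - (∑ x, ∑ z, negMulLog (p x * Wz x z))
      - ∑ y, negMulLog (∑ x, p x * Wy x y))) (sub_nonneg.2 h1)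
  linarith

/-- It suffices to check domination on probability vectors. -/
lemma dominates_of_unit {η : ℝ} {α : Bool → U → ℝ} {A : Bool → ℝ} (hα : ∀ x, ∑ u, α x u = 1)
    (h : ∀ r ∈ Set.Icc (0 : ℝ) 1, η * binEntropy r
      - ∑ u, negMulLog (r * α false u + (1 - r) * α true u) ≤ A false * r + A true * (1 - r)) :
    Dominates η α A := by
  intro a ha
  set t := ∑ x, a x with ht
  have ht' : t = a true + a false := by rw [ht, Fintype.sum_bool]
  have h0 := ha false
  have h1 := ha true
  rcases (add_nonneg h1 h0).eq_or_lt with h | htpos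
  · have z0 : a false = 0 := by linarith
    have z1 : a true = 0 := by linarith
    have zt : t = 0 := by rw [ht', z0, z1, add_zero]
    simp [zt, z0, z1]
  rw [← ht'] at htpos
  set r := a false / t with hr
  have hrt : a false = t * r := by rw [hr]; field_simp
  have hrt' : a true = t * (1 - r) := by linarith
  have hrm : r ∈ Set.Icc (0 : ℝ) 1 :=
    ⟨div_nonneg h0 htpos.le, (div_le_one htpos).2 (by linarith)⟩
  have key := mul_le_mul_of_nonneg_left (h r hrm) htpos.le
  -- Scaling a law by `t` multiplies its entropy by `t` and adds one copy of `negMulLog t`; these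
  -- copies cancel in the definition of domination.
  have e1 : ∀ u, negMulLog (∑ x, a x * α x u)
      = (r * α false u + (1 - r) * α true u) * negMulLog t
        + t * negMulLog (r * α false u + (1 - r) * α true u) := by
    intro u
    rw [← negMulLog_mul, Fintype.sum_bool, hrt, hrt']
    congr 1; ring
  have e2 : ∑ u, (r * α false u + (1 - r) * α true u) = 1 := by
    rw [Finset.sum_add_distrib, ← Finset.mul_sum, ← Finset.mul_sum, hα, hα]; ring
  have e3 : ∑ u, negMulLog (∑ x, a x * α x u)
      = negMulLog t + t * ∑ u, negMulLog (r * α false u + (1 - r) * α true u) := by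
    rw [Finset.sum_congr rfl fun u _ => e1 u, Finset.sum_add_distrib, ← Finset.sum_mul,
      ← Finset.mul_sum, e2, one_mul]
  rw [e3, Fintype.sum_bool, Fintype.sum_bool, hrt, hrt', negMulLog_mul, negMulLog_mul]
  rw [binEntropy_eq_negMulLog_add_negMulLog_one_sub] at key
  linarith

lemma sum_bool_eq {M : Type*} [AddCommMonoid M] (i : Bool) (g : Bool → M) :
    ∑ x, g x = g i + g (!i) := by
  cases i <;> simp [add_comm]

/-- Conditioning reduces entropy. -/
lemma dominates_zero {α : Bool → U → ℝ} (hα0 : ∀ x u, 0 ≤ α x u) (hα : ∀ x, ∑ u, α x u = 1) :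
    Dominates 0 α (fun x => -∑ u, negMulLog (α x u)) := by
  refine dominates_of_unit hα fun r hr => ?_
  have : ∀ u, r * negMulLog (α false u) + (1 - r) * negMulLog (α true u)
      ≤ negMulLog (r * α false u + (1 - r) * α true u) := fun u =>
    concaveOn_negMulLog.2 (hα0 false u) (hα0 true u) hr.1 (by linarith [hr.2]) (by ring)
  have := Finset.sum_le_sum (s := Finset.univ) fun u _ => this u
  rw [Finset.sum_add_distrib, ← Finset.mul_sum, ← Finset.mul_sum] at this
  linarith

/-- Subadditivity of entropy. -/
lemma entropy_subadditive {P : U → V → ℝ} (h0 : ∀ u v, 0 ≤ P u v) (h1 : ∑ u, ∑ v, P u v = 1) :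
    ∑ u, ∑ v, negMulLog (P u v)
      ≤ (∑ u, negMulLog (∑ v, P u v)) + ∑ v, negMulLog (∑ u, P u v) := by
  set q : U → ℝ := fun u => ∑ v, P u v with hq
  set s : V → ℝ := fun v => ∑ u, P u v with hs
  have q0 : ∀ u, 0 ≤ q u := fun u => Finset.sum_nonneg fun v _ => h0 u v
  have s0 : ∀ v, 0 ≤ s v := fun v => Finset.sum_nonneg fun u _ => h0 u v
  have q1 : ∑ u, q u = 1 := h1
  have s1 : ∑ v, s v = 1 := by rw [← h1, Finset.sum_comm]
  have key : ∀ u v, negMulLog (P u v)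
      ≤ -(P u v * log (q u)) - P u v * log (s v) + (q u * s v - P u v) := by
    intro u v
    rcases (h0 u v).eq_or_lt with h | hpos
    · rw [← h]; simp [mul_nonneg (q0 u) (s0 v)]
    have hqpos : 0 < q u := hpos.trans_le
      (Finset.single_le_sum (f := fun v => P u v) (fun v _ => h0 u v) (Finset.mem_univ v))
    have hspos : 0 < s v := hpos.trans_le
      (Finset.single_le_sum (f := fun u => P u v) (fun u _ => h0 u v) (Finset.mem_univ u))
    -- This is `log x ≤ x - 1` at `x = q u * s v / P u v`, multiplied by `P u v`.
    have := mul_le_mul_of_nonneg_left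
      (log_le_sub_one_of_pos (div_pos (mul_pos hqpos hspos) hpos)) hpos.le
    rw [log_div (mul_pos hqpos hspos).ne' hpos.ne', log_mul hqpos.ne' hspos.ne', mul_sub,
      mul_sub, mul_div_cancel₀ _ hpos.ne', mul_add] at this
    rw [negMulLog]
    linarith
  refine (Finset.sum_le_sum fun u _ => Finset.sum_le_sum fun v _ => key u v).trans
    (le_of_eq ?_)
  simp only [Finset.sum_add_distrib, Finset.sum_sub_distrib, Finset.sum_neg_distrib,
    ← Finset.mul_sum, s1, mul_one]
  rw [q1, sub_eq_add_neg, Finset.sum_comm (f := fun u v => P u v * log (s v)), sub_self,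
    add_zero]
  simp only [← Finset.sum_mul, negMulLog, neg_mul, Finset.sum_neg_distrib]
  rfl

end Certificate

/-! ### One-variable inequalities for binary entropy -/

lemma exists_supporting_line {f : ℝ → ℝ} (hf : ConcaveOn ℝ (Set.Icc 0 1) f) {p : ℝ}
    (hp : p ∈ Set.Ioo (0 : ℝ) 1) : ∃ m, ∀ r ∈ Set.Icc (0 : ℝ) 1, f r ≤ f p + m * (r - p) := by
  have hg : ConvexOn ℝ (Set.Icc 0 1) (-f) := hf.neg
  have hpi : p ∈ interior (Set.Icc (0 : ℝ) 1) := by rwa [interior_Icc]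
  refine ⟨-derivWithin (-f) (Set.Ioi p) p, fun r hr => ?_⟩
  rcases lt_trichotomy r p with h | h | h
  · have h1 := (hg.slope_le_leftDeriv_of_mem_interior hr hpi h).trans
      (hg.leftDeriv_le_rightDeriv_of_mem_interior hpi)
    rw [slope_def_field, div_le_iff₀ (sub_pos.2 h)] at h1
    simp only [Pi.neg_apply] at h1
    linarith
  · simp [h]
  · have h1 := hg.rightDeriv_le_slope_of_mem_interior hpi hr h
    rw [slope_def_field, le_div_iff₀ (sub_pos.2 h)] at h1
    simp only [Pi.neg_apply] at h1
    linarith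

lemma hasDerivAt_log_odds {x : ℝ} (h0 : x ≠ 0) (h1 : x ≠ 1) :
    HasDerivAt (fun x => log (1 - x) - log x) (-1 / (x * (1 - x))) x := by
  have h1' : 1 - x ≠ 0 := sub_ne_zero.2 h1.symm
  have := (((hasDerivAt_id x).const_sub 1).log h1').sub (hasDerivAt_log h0)
  refine this.congr_deriv ?_
  simp only [id]
  field_simp
  ring

/-- Strong data processing for a binary channel with parameters `α`, `β`. -/
lemma concaveOn_entropy_gap {α β η : ℝ} (hα : α ∈ Set.Icc (0 : ℝ) 1) (hβ : β ∈ Set.Icc (0 : ℝ) 1)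
    (h0 : 0 ≤ η)
    (hη : α * (1 - β) + β * (1 - α) - 2 * √(α * (1 - α) * (β * (1 - β))) ≤ η) :
    ConcaveOn ℝ (Set.Icc 0 1)
      (fun r => η * binEntropy r - binEntropy (r * α + (1 - r) * β)) := by
  rcases eq_or_ne α β with rfl | hne
  · have : (fun r => η * binEntropy r - binEntropy (r * α + (1 - r) * α))
        = fun r => η • binEntropy r + (-binEntropy α) := by
      funext r; rw [← add_mul]; simp [sub_eq_add_neg]
    rw [this]
    exact (strictConcave_binEntropy.concaveOn.smul h0).add_const _
  obtain ⟨ha0, ha1⟩ := hα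
  obtain ⟨hb0, hb1⟩ := hβ
  -- A strict mixture of `α` and `β` reaches an endpoint only if both equal that endpoint, which
  -- `hne` excludes.
  have hw : ∀ r ∈ Set.Ioo (0 : ℝ) 1,
      r * α + (1 - r) * β ≠ 0 ∧ r * α + (1 - r) * β ≠ 1 := by
    rintro r ⟨hr0, hr1⟩
    have hr1' : 0 < 1 - r := by linarith
    constructor
    · intro h
      have e1 : r * α = 0 := by nlinarith [mul_nonneg hr0.le ha0, mul_nonneg hr1'.le hb0]
      have e2 : (1 - r) * β = 0 := by linarith
      rcases mul_eq_zero.1 e1 with e | e <;> rcases mul_eq_zero.1 e2 with e' | e'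
      any_goals linarith
      exact hne (e.trans e'.symm)
    · intro h
      have m1 := mul_nonneg hr0.le (sub_nonneg.2 ha1)
      have m2 := mul_nonneg hr1'.le (sub_nonneg.2 hb1)
      have e1 : r * (1 - α) = 0 := by linarith
      have e2 : (1 - r) * (1 - β) = 0 := by linarith
      rcases mul_eq_zero.1 e1 with e | e <;> rcases mul_eq_zero.1 e2 with e' | e'
      any_goals linarith
      exact hne (by linarith)
  have hlin : ∀ r : ℝ, HasDerivAt (fun r => r * α + (1 - r) * β) (α - β) r := fun r => by
    have := ((hasDerivAt_id r).mul_const α).add (((hasDerivAt_id r).const_sub 1).mul_const β)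
    exact this.congr_deriv (by simp; ring)
  refine concaveOn_of_hasDerivWithinAt2_nonpos (convex_Icc 0 1) (by fun_prop)
    (f' := fun r => η * (log (1 - r) - log r)
      - (log (1 - (r * α + (1 - r) * β)) - log (r * α + (1 - r) * β)) * (α - β))
    (f'' := fun r => η * (-1 / (r * (1 - r)))
      - (-1 / ((r * α + (1 - r) * β) * (1 - (r * α + (1 - r) * β))) * (α - β)) * (α - β))
    ?_ ?_ ?_ <;> rw [interior_Icc] <;> intro r hr <;> obtain ⟨w0, w1⟩ := hw r hr
  · exact (((hasDerivAt_binEntropy hr.1.ne' hr.2.ne).const_mul η).sub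
      (HasDerivAt.comp r (hasDerivAt_binEntropy w0 w1) (hlin r))).hasDerivWithinAt
  · exact (((hasDerivAt_log_odds hr.1.ne' hr.2.ne).const_mul η).sub
      ((HasDerivAt.comp r (hasDerivAt_log_odds w0 w1) (hlin r)).mul_const (α - β))).hasDerivWithinAt
  · obtain ⟨hr0, hr1⟩ := hr
    have hr1' : 0 < 1 - r := by linarith
    have hrr := mul_pos hr0 hr1'
    set w := r * α + (1 - r) * β with hwdef
    have hwpos : 0 < w := lt_of_le_of_ne
      (add_nonneg (mul_nonneg hr0.le ha0) (mul_nonneg hr1'.le hb0)) (Ne.symm w0)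
    have hwlt : 0 < 1 - w := by
      refine lt_of_le_of_ne ?_ (sub_ne_zero.2 w1.symm).symm
      nlinarith [mul_nonneg hr0.le (sub_nonneg.2 ha1), mul_nonneg hr1'.le (sub_nonneg.2 hb1)]
    have hww := mul_pos hwpos hwlt
    set a := α * (1 - α) with hadef
    set b := β * (1 - β) with hbdef
    have haa : 0 ≤ a := mul_nonneg ha0 (by linarith)
    have hbb : 0 ≤ b := mul_nonneg hb0 (by linarith)
    set D := √(a * b) with hD
    have hDsq : D ^ 2 = a * b := sq_sqrt (mul_nonneg haa hbb)
    have hD0 : 0 ≤ D := sqrt_nonneg _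
    have hDab : D = √a * √b := sqrt_mul haa b
    set P := α * (1 - β) + β * (1 - α) with hP
    have hP0 : 0 ≤ P := add_nonneg (mul_nonneg ha0 (by linarith)) (mul_nonneg hb0 (by linarith))
    -- Nonpositivity of the second derivative is `(α - β)² r(1-r) ≤ η w(1-w)`. The
    -- arithmetic-geometric mean inequality gives `w(1-w) ≥ r(1-r)(P + 2D)`, and `(α - β)²` factors
    -- as `(P - 2D)(P + 2D)` with `P - 2D ≤ η`.
    have e1 : w * (1 - w) = r ^ 2 * a + (1 - r) ^ 2 * b + r * (1 - r) * P := by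
      rw [hwdef, hadef, hbdef, hP]; ring
    have e2 : 2 * (r * (1 - r) * D) ≤ r ^ 2 * a + (1 - r) ^ 2 * b := by
      have := sq_nonneg (r * √a - (1 - r) * √b)
      have sa := sq_sqrt haa
      have sb := sq_sqrt hbb
      rw [hDab]
      nlinarith
    have e3 : (α - β) ^ 2 = (P - 2 * D) * (P + 2 * D) := by
      have : (P - 2 * D) * (P + 2 * D) = P ^ 2 - 4 * D ^ 2 := by ring
      rw [this, hDsq, hP, hadef, hbdef]; ring
    have e4 : (α - β) ^ 2 * (r * (1 - r)) ≤ η * (w * (1 - w)) := by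
      calc (α - β) ^ 2 * (r * (1 - r)) = (P - 2 * D) * ((P + 2 * D) * (r * (1 - r))) := by
            rw [e3]; ring
        _ ≤ η * ((P + 2 * D) * (r * (1 - r))) :=
            mul_le_mul_of_nonneg_right hη (by positivity)
        _ ≤ η * (w * (1 - w)) := mul_le_mul_of_nonneg_left (by rw [e1]; linarith) h0
    have e5 : (α - β) ^ 2 / (w * (1 - w)) ≤ η / (r * (1 - r)) := by
      rw [div_le_div_iff₀ hww hrr]; exact e4
    have : η * (-1 / (r * (1 - r))) - -1 / (w * (1 - w)) * (α - β) * (α - β)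
        = (α - β) ^ 2 / (w * (1 - w)) - η / (r * (1 - r)) := by ring
    simp only [this]
    linarith

/-- Strong data processing for a Z-channel. The parameter `η` is determined by the reference
input `s`. -/
lemma entropy_gap_ge_of_log_eq {a s η : ℝ} (ha0 : 0 < a) (ha1 : a < 1) (hs0 : 0 < s) (hs1 : s < 1)
    (h0 : 0 ≤ η) (h1 : η ≤ 1) (hη : log (1 - a * s) = η * log (1 - s)) {r : ℝ}
    (hr : r ∈ Set.Icc (0 : ℝ) 1) :
    (binEntropy (a * s) - η * binEntropy s) / s * r ≤ binEntropy (a * r) - η * binEntropy r := by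
  -- The claim is that `F` is minimal at `s`. Since `h(x) - x h'(x) = -log (1 - x)`, the sign of
  -- `F'` is that of `log (1 - a r) - η log (1 - r)`.
  set F : ℝ → ℝ := fun r => (binEntropy (a * r) - η * binEntropy r) / r with hF
  have has : a * s < 1 := by nlinarith
  have hpow : (1 - s) ^ η = 1 - a * s := by
    rw [rpow_def_of_pos (by linarith), mul_comm, ← hη, exp_log (by linarith)]
  have hder : ∀ r ∈ Set.Ioo (0 : ℝ) 1,
      HasDerivAt F ((log (1 - a * r) - η * log (1 - r)) / r ^ 2) r := by
    rintro r ⟨hr0, hr1⟩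
    have har0 : 0 < a * r := mul_pos ha0 hr0
    have har1 : a * r < 1 := by nlinarith
    have d1 : HasDerivAt (fun r => a * r) a r := by
      simpa using (hasDerivAt_id r).const_mul a
    have d2 := ((HasDerivAt.comp r (hasDerivAt_binEntropy har0.ne' har1.ne) d1).sub
      ((hasDerivAt_binEntropy hr0.ne' hr1.ne).const_mul η)).div (hasDerivAt_id r) hr0.ne'
    refine d2.congr_deriv ?_
    simp only [Pi.sub_apply, Function.comp, id]
    congr 1
    rw [binEntropy_eq_negMulLog_add_negMulLog_one_sub, binEntropy_eq_negMulLog_add_negMulLog_one_sub,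
      negMulLog, negMulLog, negMulLog, negMulLog]
    ring
  have hcont : ∀ S ⊆ Set.Ioi (0 : ℝ), ContinuousOn F S := fun S hS =>
    ContinuousOn.div (by fun_prop) continuousOn_id fun x hx => (hS hx).ne'
  have hconc := Real.concaveOn_rpow h0 h1
  -- The concave `(1 - r) ^ η` and the affine `1 - a r` agree at `0` and, by `hη`, at `s`. Hence the
  -- power lies above the line before `s` and below it afterwards.
  have hsign : ∀ r ∈ Set.Ioo (0 : ℝ) 1, (r ≤ s → log (1 - a * r) - η * log (1 - r) ≤ 0)
      ∧ (s ≤ r → 0 ≤ log (1 - a * r) - η * log (1 - r)) := by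
    rintro r ⟨hr0, hr1⟩
    have har1 : a * r < 1 := by nlinarith
    have hlog : η * log (1 - r) = log ((1 - r) ^ η) := (log_rpow (by linarith) η).symm
    constructor
    · intro hrs
      have := hconc.2 (show 1 - s ∈ Set.Ici (0 : ℝ) by simp; linarith)
        (show (1 : ℝ) ∈ Set.Ici (0 : ℝ) by simp) (show 0 ≤ r / s by positivity)
        (show 0 ≤ 1 - r / s by rw [sub_nonneg, div_le_one hs0]; exact hrs) (by ring)
      simp only [smul_eq_mul, hpow, one_rpow] at this
      have e1 : r / s * (1 - a * s) + (1 - r / s) * 1 = 1 - a * r := by field_simp; ring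
      have e2 : r / s * (1 - s) + (1 - r / s) * 1 = 1 - r := by field_simp; ring
      rw [e1, e2] at this
      rw [hlog, sub_nonpos]
      exact log_le_log (by linarith) this
    · intro hsr
      have := hconc.2 (show 1 - r ∈ Set.Ici (0 : ℝ) by simp; linarith)
        (show (1 : ℝ) ∈ Set.Ici (0 : ℝ) by simp) (show 0 ≤ s / r by positivity)
        (show 0 ≤ 1 - s / r by rw [sub_nonneg, div_le_one hr0]; exact hsr) (by ring)
      have e2 : s / r * (1 - r) + (1 - s / r) * 1 = 1 - s := by field_simp; ring
      simp only [smul_eq_mul, one_rpow, e2, hpow] at this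
      have e1 : s / r * (1 - r) ^ η - s / r * (1 - a * r) ≤ 0 := by
        have : s / r * (1 - a * r) = s / r - a * s := by field_simp
        linarith
      rw [← mul_sub] at e1
      have e3 : (1 - r) ^ η ≤ 1 - a * r := by
        by_contra hcon
        push Not at hcon
        have := mul_pos (div_pos hs0 hr0) (sub_pos.2 hcon)
        linarith
      rw [hlog, sub_nonneg]
      exact log_le_log (rpow_pos_of_pos (by linarith) _) e3
  rcases hr.1.eq_or_lt with h | hr0
  · rw [← h]; simp
  have key : F s ≤ F r := by
    rcases le_total r s with hrs | hsr
    · have hanti : AntitoneOn F (Set.Ioc 0 s) := by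
        refine antitoneOn_of_deriv_nonpos (convex_Ioc 0 s) (hcont _ fun x hx => hx.1) ?_ ?_ <;>
          rw [interior_Ioc] <;> intro x hx
        · exact (hder x ⟨hx.1, hx.2.trans hs1⟩).differentiableAt.differentiableWithinAt
        · rw [(hder x ⟨hx.1, hx.2.trans hs1⟩).deriv]
          exact div_nonpos_of_nonpos_of_nonneg ((hsign x ⟨hx.1, hx.2.trans hs1⟩).1 hx.2.le)
            (sq_nonneg _)
      exact hanti ⟨hr0, hrs⟩ ⟨hs0, le_rfl⟩ hrs
    · have hmono : MonotoneOn F (Set.Icc s 1) := by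
        refine monotoneOn_of_deriv_nonneg (convex_Icc s 1) (hcont _ fun x hx => hs0.trans_le hx.1)
          ?_ ?_ <;> rw [interior_Icc] <;> intro x hx
        · exact (hder x ⟨hs0.trans hx.1, hx.2⟩).differentiableAt.differentiableWithinAt
        · rw [(hder x ⟨hs0.trans hx.1, hx.2⟩).deriv]
          exact div_nonneg ((hsign x ⟨hs0.trans hx.1, hx.2⟩).2 hx.1.le) (sq_nonneg _)
      exact hmono ⟨le_rfl, hs1.le⟩ ⟨hsr, hr.2⟩ hsr
  exact (le_div_iff₀ hr0).1 key

/-! ### Symmetry and degenerate input -/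

section Swap
variable {U V Y Z : Type*} [Fintype U] [Fintype V] [Fintype Y] [Fintype Z]

lemma auxValue_swap (Wy : Bool → Y → ℝ) (Wz : Bool → Z → ℝ) (w : U → V → Bool → ℝ) :
    auxValue Wz Wy (fun v u x => w u v x) = auxValue Wy Wz w := by
  unfold auxValue
  rw [Finset.sum_comm (f := fun v u => negMulLog (∑ x, w u v x))]
  ring

lemma inputBound_swap (Wy : Bool → Y → ℝ) (Wz : Bool → Z → ℝ) (p : Bool → ℝ) :
    inputBound Wz Wy p = inputBound Wy Wz p := max_comm _ _

/-- With `X` constant, `Y` and `Z` are independent of `U` and `V`, and the claim becomes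
subadditivity of `H(U,V)`. -/
lemma auxValue_le_of_eq_zero {Wy : Bool → Y → ℝ} {Wz : Bool → Z → ℝ}
    (hWy1 : ∀ x, ∑ y, Wy x y = 1) (hWz1 : ∀ x, ∑ z, Wz x z = 1)
    {w : U → V → Bool → ℝ} (hw : ∀ u v x, 0 ≤ w u v x) {p : Bool → ℝ}
    (hp : ∀ x, ∑ u, ∑ v, w u v x = p x) (hp1 : ∑ x, p x = 1) {i : Bool} (hi : p i = 0) :
    auxValue Wy Wz w ≤ inputBound Wy Wz p := by
  have hz : ∀ u v, w u v i = 0 := by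
    intro u v
    have h1 := (Finset.sum_eq_zero_iff_of_nonneg
      fun u _ => Finset.sum_nonneg fun v _ => hw u v i).1 ((hp i).trans hi) u (mem_univ u)
    exact (Finset.sum_eq_zero_iff_of_nonneg fun v _ => hw u v i).1 h1 v (mem_univ v)
  have hp1' : p (!i) = 1 := by rw [sum_bool_eq i, hi, zero_add] at hp1; exact hp1
  have hs := entropy_subadditive (P := fun u v => w u v (!i)) (fun u v => hw u v _)
    ((hp _).trans hp1')
  have hsU : ∑ u, ∑ v, w u v (!i) = 1 := (hp _).trans hp1'
  have hsV : ∑ v, ∑ u, w u v (!i) = 1 := by rw [Finset.sum_comm]; exact hsU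
  unfold auxValue inputBound
  simp only [sum_bool_eq i, hz, hi, hp1', Finset.sum_const_zero, zero_mul, zero_add, one_mul,
    negMulLog_mul, negMulLog_zero, negMulLog_one, Finset.sum_add_distrib,
    ← Finset.mul_sum, ← Finset.sum_mul, hWy1, hWz1, hsU, hsV]
  exact le_max_of_le_left (by linarith)

end Swap

/-! ### Binary auxiliary variables: setup -/

section Binary
variable {Y Z : Type*} [Fintype Y] [Fintype Z]

lemma dominates_of_unit' {U : Type*} [Fintype U] {η : ℝ} {α : Bool → U → ℝ} {A : Bool → ℝ}
    (i : Bool) (hα : ∀ x, ∑ u, α x u = 1)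
    (h : ∀ r ∈ Set.Icc (0 : ℝ) 1, η * binEntropy r
      - ∑ u, negMulLog (r * α i u + (1 - r) * α (!i) u) ≤ A i * r + A (!i) * (1 - r)) :
    Dominates η α A := by
  refine dominates_of_unit hα ?_
  cases i
  · exact h
  · intro r hr
    have := h (1 - r) ⟨by linarith [hr.2], by linarith [hr.1]⟩
    simp only [binEntropy_one_sub, sub_sub_cancel, Bool.not_true] at this
    simp only [add_comm (r * _)]
    linarith

/-- The relation of the law of `(U,V,X)` to the law `p` of `X`. -/
structure IsJointLaw {U V : Type*} [Fintype U] [Fintype V] (w : U → V → Bool → ℝ)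
    (p : Bool → ℝ) : Prop where
  nonneg : ∀ u v x, 0 ≤ w u v x
  sum_eq : ∀ x, ∑ u, ∑ v, w u v x = p x
  sum_eq_one : ∑ x, p x = 1

lemma IsJointLaw.swap {U V : Type*} [Fintype U] [Fintype V] {w : U → V → Bool → ℝ}
    {p : Bool → ℝ} (h : IsJointLaw w p) : IsJointLaw (fun v u x => w u v x) p :=
  ⟨fun v u x => h.nonneg u v x, fun x => by rw [Finset.sum_comm]; exact h.sum_eq x, h.sum_eq_one⟩

/-- A pair of stochastic matrices with binary input. -/
structure IsChannelPair (Wy : Bool → Y → ℝ) (Wz : Bool → Z → ℝ) : Prop where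
  nonneg_fst : ∀ x y, 0 ≤ Wy x y
  sum_fst : ∀ x, ∑ y, Wy x y = 1
  nonneg_snd : ∀ x z, 0 ≤ Wz x z
  sum_snd : ∀ x, ∑ z, Wz x z = 1

lemma IsChannelPair.swap {Wy : Bool → Y → ℝ} {Wz : Bool → Z → ℝ} (h : IsChannelPair Wy Wz) :
    IsChannelPair Wz Wy := ⟨h.3, h.4, h.1, h.2⟩

variable {Wy : Bool → Y → ℝ} {Wz : Bool → Z → ℝ}

lemma IsJointLaw.nonneg_marginal {U V : Type*} [Fintype U] [Fintype V] {w : U → V → Bool → ℝ}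
    {p : Bool → ℝ} (h : IsJointLaw w p) (x : Bool) : 0 ≤ p x := by
  rw [← h.sum_eq]; exact sum_nonneg fun u _ => sum_nonneg fun v _ => h.nonneg u v x

end Binary

/-! ### Binary auxiliary variables: projection, exclusive or, conjunction -/

section Binary
variable {Y Z : Type*} [Fintype Y] [Fintype Z] {Wy : Bool → Y → ℝ} {Wz : Bool → Z → ℝ}

lemma sum_sum_bool_eq (i j : Bool) (g : Bool → Bool → ℝ) :
    ∑ u, ∑ v, g u v = g i j + g i (!j) + (g (!i) j + g (!i) (!j)) := by
  rw [sum_bool_eq i, sum_bool_eq j, sum_bool_eq j]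

/-- The case in which `X` is a bijective function of `U`. -/
lemma auxValue_le_of_eq_fst (hW : IsChannelPair Wy Wz) {w : Bool → Bool → Bool → ℝ} {p : Bool → ℝ}
    (hw : IsJointLaw w p) (hp : ∀ x, 0 < p x) {k : Bool}
    (h : ∀ u v x, x ≠ xor u k → w u v x = 0) :
    auxValue Wy Wz w ≤ inputBound Wy Wz p := by
  set β : Bool → Bool → ℝ := fun x v => (∑ u, w u v x) / p x with hβdef
  have hβ : ∀ v x, ∑ u, w u v x = p x * β x v := fun v x => by
    rw [hβdef]; field_simp [(hp x).ne']
  have hβ0 : ∀ x v, 0 ≤ β x v := fun x v =>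
    div_nonneg (sum_nonneg fun u _ => hw.nonneg u v x) (hp x).le
  have hβ1 : ∀ x, ∑ v, β x v = 1 := fun x => by
    simp only [hβdef]
    rw [← Finset.sum_div, Finset.sum_comm, hw.sum_eq, div_self (hp x).ne']
  have hsnd := dominates_zero hβ0 hβ1
  -- As `U` and `X` determine each other, `H(X) - H(U) = 0`. So `η = 1` works with `A = 0`, and
  -- `H(U,V) = H(X) + H(V|X)` is balanced by `B`.
  have hfst : Dominates 1 (fun x u : Bool => if x = xor u k then (1 : ℝ) else 0) (fun _ => 0) := by
    intro a _
    cases k <;> simp [add_comm]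
  refine auxValue_le_of_dominates hW.1 hW.2 hW.3 hW.4 hw.nonneg_marginal zero_le_one le_rfl
    (α := fun x u => if x = xor u k then 1 else 0) (β := β) ?_ hβ hfst
    (by rw [sub_self]; exact hsnd) ?_
  · intro u x
    have hsum := hw.sum_eq x
    rw [sum_bool_eq (xor x k)] at hsum
    have hz : ∀ v, w (!(xor x k)) v x = 0 := fun v => h _ _ _ (by cases x <;> cases k <;> decide)
    split_ifs with hx
    · have : u = xor x k := by subst hx; cases u <;> cases k <;> rfl
      subst this
      simp only [hz, Finset.sum_const_zero, add_zero] at hsum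
      rw [hsum, mul_one]
    · simp [h u _ x hx]
  · have e1 : ∀ x, p x * ∑ v, negMulLog (β x v)
        = (∑ v, negMulLog (∑ u, w u v x)) - negMulLog (p x) := by
      intro x
      simp only [hβ, negMulLog_mul, Finset.sum_add_distrib, ← Finset.sum_mul, ← Finset.mul_sum, hβ1]
      ring
    have e2 : ∑ u, ∑ v, negMulLog (∑ x, w u v x) = ∑ x, ∑ v, negMulLog (∑ u, w u v x) := by
      cases k
      · simp [h false _ true, h true _ false]
      · simp [h false _ false, h true _ true, add_comm]
    have e3 : ∑ x, (0 + -∑ v, negMulLog (β x v)) * p x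
        = ∑ x, (negMulLog (p x) - ∑ v, negMulLog (∑ u, w u v x)) :=
      Finset.sum_congr rfl fun x _ => by rw [zero_add, neg_mul, mul_comm, e1]; ring
    rw [e2, e3, Finset.sum_sub_distrib]
    linarith

lemma auxValue_le_of_eq_snd (hW : IsChannelPair Wy Wz) {w : Bool → Bool → Bool → ℝ} {p : Bool → ℝ}
    (hw : IsJointLaw w p) (hp : ∀ x, 0 < p x) {k : Bool}
    (h : ∀ u v x, x ≠ xor v k → w u v x = 0) :
    auxValue Wy Wz w ≤ inputBound Wy Wz p := by
  rw [← auxValue_swap, ← inputBound_swap]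
  exact auxValue_le_of_eq_fst hW.swap hw.swap hp fun u v x => h v u x

/-- The certificate is the tangent at `p` to the concave gap function, so domination is an equality
at the actual law of `X`. -/
lemma exists_dominates_of_le {η : ℝ} (h0 : 0 ≤ η) {α : Bool → Bool → ℝ}
    (hα0 : ∀ x u, 0 ≤ α x u) (hα1 : ∀ x, ∑ u, α x u = 1)
    (hη : α false false * (1 - α true false) + α true false * (1 - α false false)
      - 2 * √(α false false * (1 - α false false) * (α true false * (1 - α true false))) ≤ η)
    {p : Bool → ℝ} (hp : ∀ x, 0 < p x) (hp1 : ∑ x, p x = 1) :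
    ∃ A, Dominates η α A ∧
      ∑ x, A x * p x = η * (∑ x, negMulLog (p x)) - ∑ u, negMulLog (∑ x, p x * α x u) := by
  have hαt : ∀ x, α x true = 1 - α x false := fun x => by
    have := hα1 x; rw [Fintype.sum_bool] at this; linarith
  have hmem : ∀ x, α x false ∈ Set.Icc (0 : ℝ) 1 := fun x =>
    ⟨hα0 x _, by have := hα0 x true; rw [hαt] at this; linarith⟩
  have hpt : p true = 1 - p false := by rw [Fintype.sum_bool] at hp1; linarith
  have hval : ∀ r : ℝ, ∑ u, negMulLog (r * α false u + (1 - r) * α true u)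
      = binEntropy (r * α false false + (1 - r) * α true false) := fun r => by
    rw [Fintype.sum_bool, hαt, hαt, binEntropy_eq_negMulLog_add_negMulLog_one_sub, add_comm]
    congr 2; ring
  obtain ⟨m, hm⟩ := exists_supporting_line (concaveOn_entropy_gap (hmem false) (hmem true) h0 hη)
    (p := p false) ⟨hp false, by linarith [hp true]⟩
  set c := η * binEntropy (p false)
    - binEntropy (p false * α false false + (1 - p false) * α true false) with hc
  refine ⟨fun x => if x then c - m * p false else c + m * (1 - p false), ?_, ?_⟩
  · refine dominates_of_unit hα1 fun r hr => ?_
    rw [hval]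
    have := hm r hr
    simp only [Bool.false_eq_true, if_false, if_true]
    linarith
  · have : ∀ u, ∑ x, p x * α x u = p false * α false u + (1 - p false) * α true u := fun u => by
      rw [Fintype.sum_bool, hpt, add_comm]
    simp only [this]
    rw [hval, Fintype.sum_bool, Fintype.sum_bool, hpt]
    simp only [Bool.false_eq_true, if_false, if_true]
    rw [add_comm (negMulLog _), ← binEntropy_eq_negMulLog_add_negMulLog_one_sub, hc]
    ring

/-- The case in which `X` is the sum of `U` and `V` modulo two. -/
lemma auxValue_le_of_eq_xor (hW : IsChannelPair Wy Wz) {w : Bool → Bool → Bool → ℝ} {p : Bool → ℝ}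
    (hw : IsJointLaw w p) (hp : ∀ x, 0 < p x) {k : Bool}
    (h : ∀ u v x, x ≠ xor (xor u v) k → w u v x = 0) :
    auxValue Wy Wz w ≤ inputBound Wy Wz p := by
  set α : Bool → Bool → ℝ := fun x u => (∑ v, w u v x) / p x with hαdef
  set β : Bool → Bool → ℝ := fun x v => (∑ u, w u v x) / p x with hβdef
  have hα : ∀ u x, ∑ v, w u v x = p x * α x u := fun u x => by
    rw [hαdef]; field_simp [(hp x).ne']
  have hβ : ∀ v x, ∑ u, w u v x = p x * β x v := fun v x => by
    rw [hβdef]; field_simp [(hp x).ne']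
  have hα0 : ∀ x u, 0 ≤ α x u := fun x u =>
    div_nonneg (sum_nonneg fun v _ => hw.nonneg u v x) (hp x).le
  have hβ0 : ∀ x v, 0 ≤ β x v := fun x v =>
    div_nonneg (sum_nonneg fun u _ => hw.nonneg u v x) (hp x).le
  have hα1 : ∀ x, ∑ u, α x u = 1 := fun x => by
    simp only [hαdef]
    rw [← Finset.sum_div, hw.sum_eq, div_self (hp x).ne']
  have hβ1 : ∀ x, ∑ v, β x v = 1 := fun x => by
    simp only [hβdef]
    rw [← Finset.sum_div, Finset.sum_comm, hw.sum_eq, div_self (hp x).ne']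
  -- Given `X = x`, each of `U` and `V` determines the other.
  have hβα : ∀ x v, β x v = α x (xor (xor x v) k) := by
    intro x v
    simp only [hαdef, hβdef]
    congr 1
    rw [sum_bool_eq (xor (xor x v) k), sum_bool_eq v]
    rw [h (!(xor (xor x v) k)) v x (by cases x <;> cases v <;> cases k <;> decide),
      h (xor (xor x v) k) (!v) x (by cases x <;> cases v <;> cases k <;> decide)]
  have hαt : ∀ x, α x true = 1 - α x false := fun x => by
    have := hα1 x; rw [Fintype.sum_bool] at this; linarith
  have h1a : ∀ x, 0 ≤ 1 - α x false := fun x => hαt x ▸ hα0 x true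
  set a := α false false with ha
  set b := α true false with hb
  have a0 : 0 ≤ a := hα0 _ _
  have b0 : 0 ≤ b := hα0 _ _
  have a1 : 0 ≤ 1 - a := h1a _
  have b1 : 0 ≤ 1 - b := h1a _
  set D := √(a * (1 - a) * (b * (1 - b))) with hD
  have hD0 : 0 ≤ D := sqrt_nonneg _
  have hDsq : D ^ 2 = a * (1 - a) * (b * (1 - b)) :=
    sq_sqrt (mul_nonneg (mul_nonneg a0 a1) (mul_nonneg b0 b1))
  have hη0 : 0 ≤ a * (1 - b) + b * (1 - a) - 2 * D := by
    have h1 : (2 * D) ^ 2 ≤ (a * (1 - b) + b * (1 - a)) ^ 2 := by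
      nlinarith [sq_nonneg (a * (1 - b) - b * (1 - a))]
    have := (sq_le_sq₀ (by positivity)
      (add_nonneg (mul_nonneg a0 b1) (mul_nonneg b0 a1))).1 h1
    linarith
  have hη1 : 0 ≤ 1 - (a * (1 - b) + b * (1 - a) - 2 * D) := by
    nlinarith [mul_nonneg a0 b0, mul_nonneg a1 b1]
  obtain ⟨A, hA, hAp⟩ := exists_dominates_of_le hη0 hα0 hα1 le_rfl hp hw.sum_eq_one
  -- With `P = a(1-b) + b(1-a)`, the constant required for `U` is `η = P - 2D`. Flipping one of the
  -- two parameters turns `P` into `1 - P` and keeps `D`, so `V` requires `1 - P - 2D`, at most `1 -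
  -- η`.
  obtain ⟨B, hB, hBp⟩ := exists_dominates_of_le hη1 hβ0 hβ1 (by
    cases k
    · simp only [hβα, Bool.xor_false, hαt, Bool.xor_self, ← ha, ← hb]
      rw [show a * (1 - a) * ((1 - b) * (1 - (1 - b))) = a * (1 - a) * (b * (1 - b)) by ring, ← hD]
      linarith
    · simp only [hβα, Bool.xor_false, hαt, Bool.xor_self, Bool.xor_true, Bool.not_false,
        ← ha, ← hb]
      rw [show (1 - a) * (1 - (1 - a)) * (b * (1 - b)) = a * (1 - a) * (b * (1 - b)) by ring, ← hD]
      linarith) hp hw.sum_eq_one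
  refine auxValue_le_of_dominates hW.1 hW.2 hW.3 hW.4 hw.nonneg_marginal hη0 (sub_nonneg.1 hη1)
    hα hβ hA hB ?_
  simp only [add_mul, Finset.sum_add_distrib, hAp, hBp, ← hα, ← hβ]
  -- The tangents contribute `H(X) - H(U) - H(V)`, so only `H(U,V) ≤ H(U) + H(V)` remains.
  have hs := entropy_subadditive (P := fun u v => ∑ x, w u v x)
    (fun u v => sum_nonneg fun x _ => hw.nonneg u v x) (by
      rw [← hw.sum_eq_one]
      simp only [← hw.sum_eq]
      rw [Finset.sum_comm' (t' := univ) (s' := fun _ => univ) (by simp)]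
      simp only [Fintype.sum_bool]; ring)
  have c1 : ∀ u, ∑ x, ∑ v, w u v x = ∑ v, ∑ x, w u v x := fun u => Finset.sum_comm
  have c2 : ∀ v, ∑ x, ∑ u, w u v x = ∑ u, ∑ x, w u v x := fun v => Finset.sum_comm
  simp only [c1, c2]
  linarith

/-- Let `s = a / ((a+b)(a+c))` be the probability that `X ≠ x₀` in the conjunction case. Then `U`
and `V` are independent, so `H(U) + H(V) = H(U,V) = h(s) + s H(a,b,c)`; solving for `H(a,b,c)` gives
the identity. -/
lemma entropy_of_independent_complement {a b c : ℝ} (ha : 0 < a) (hb : 0 < b) (hc : 0 < c)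
    (h1 : a + b + c = 1) :
    (binEntropy (a / (a + b)) + binEntropy (a / (a + c)) - binEntropy (a / ((a + b) * (a + c))))
      / (a / ((a + b) * (a + c))) = negMulLog a + negMulLog b + negMulLog c := by
  have hs : 0 < a + b := by linarith
  have ht : 0 < a + c := by linarith
  have e1 : 1 - a / (a + b) = b / (a + b) := by field_simp; ring
  have e2 : 1 - a / (a + c) = c / (a + c) := by field_simp; ring
  have e3 : 1 - a / ((a + b) * (a + c)) = b * c / ((a + b) * (a + c)) := by
    field_simp
    have : c = 1 - a - b := by linarith
    subst this; ring
  simp only [binEntropy_eq_negMulLog_add_negMulLog_one_sub, e1, e2, e3, negMulLog]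
  rw [log_div ha.ne' hs.ne', log_div hb.ne' hs.ne', log_div ha.ne' ht.ne', log_div hc.ne' ht.ne',
    log_div ha.ne' (mul_pos hs ht).ne', log_div (mul_pos hb hc).ne' (mul_pos hs ht).ne',
    log_mul hs.ne' ht.ne', log_mul hb.ne' hc.ne']
  generalize log a = la, log b = lb, log c = lc, log (a + b) = ls, log (a + c) = lt
  rw [div_eq_iff (by positivity)]
  field_simp
  have : c = 1 - a - b := by linarith
  subst this
  ring

/-- The case in which `X` is the conjunction of `U` and `V` up to relabelling. -/
lemma auxValue_le_of_eq_and (hW : IsChannelPair Wy Wz) {w : Bool → Bool → Bool → ℝ} {p : Bool → ℝ}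
    (hw : IsJointLaw w p) (hp : ∀ x, 0 < p x) {u₀ v₀ x₀ : Bool}
    (h : ∀ u v x, ¬(x = x₀ ↔ u = u₀ ∧ v = v₀) → w u v x = 0)
    (ha : 0 < w (!u₀) (!v₀) (!x₀)) (hb : 0 < w u₀ (!v₀) (!x₀)) (hc : 0 < w (!u₀) v₀ (!x₀)) :
    auxValue Wy Wz w ≤ inputBound Wy Wz p := by
  have hq := hp (!x₀)
  have z1 : w u₀ v₀ (!x₀) = 0 := h _ _ _ (by simp)
  have z2 : w (!u₀) v₀ x₀ = 0 := h _ _ _ (by simp)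
  have z3 : w u₀ (!v₀) x₀ = 0 := h _ _ _ (by simp)
  have z4 : w (!u₀) (!v₀) x₀ = 0 := h _ _ _ (by simp)
  have hp0 : p x₀ = w u₀ v₀ x₀ := by
    rw [← hw.sum_eq, sum_sum_bool_eq u₀ v₀, z2, z3, z4]; ring
  have hp1 : p (!x₀) = w (!u₀) (!v₀) (!x₀) + w u₀ (!v₀) (!x₀) + w (!u₀) v₀ (!x₀) := by
    rw [← hw.sum_eq, sum_sum_bool_eq u₀ v₀, z1]; ring
  obtain ⟨a, hwa⟩ : ∃ a, w (!u₀) (!v₀) (!x₀) = p (!x₀) * a := ⟨_, (mul_div_cancel₀ _ hq.ne').symm⟩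
  obtain ⟨b, hwb⟩ : ∃ b, w u₀ (!v₀) (!x₀) = p (!x₀) * b := ⟨_, (mul_div_cancel₀ _ hq.ne').symm⟩
  obtain ⟨c, hwc⟩ : ∃ c, w (!u₀) v₀ (!x₀) = p (!x₀) * c := ⟨_, (mul_div_cancel₀ _ hq.ne').symm⟩
  rw [hwa] at ha; rw [hwb] at hb; rw [hwc] at hc
  rw [hwa, hwb, hwc] at hp1
  replace ha := pos_of_mul_pos_right ha hq.le
  replace hb := pos_of_mul_pos_right hb hq.le
  replace hc := pos_of_mul_pos_right hc hq.le
  have habc : a + b + c = 1 := by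
    have : p (!x₀) * (a + b + c) = p (!x₀) * 1 := by linarith
    exact mul_left_cancel₀ hq.ne' this
  have hs : 0 < a + b := by linarith
  have ht : 0 < a + c := by linarith
  -- The reference probability of `!x₀` that makes `U` and `V` independent; `e3` says that the cell
  -- `(u₀, v₀)` has product mass.
  set s := a / ((a + b) * (a + c)) with hsdef
  have e1 : (a + c) * s = a / (a + b) := by rw [hsdef]; field_simp
  have e2 : (a + b) * s = a / (a + c) := by rw [hsdef]; field_simp
  have e3 : 1 - s = (1 - (a + c) * s) * (1 - (a + b) * s) := by
    rw [e1, e2, hsdef]; field_simp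
    have : c = 1 - a - b := by linarith
    subst this; ring
  have g1 : 0 < 1 - (a + c) * s := by rw [e1, sub_pos, div_lt_one hs]; linarith
  have g2 : 0 < 1 - (a + b) * s := by rw [e2, sub_pos, div_lt_one ht]; linarith
  have hs0 : 0 < s := by positivity
  have l1 : log (1 - (a + c) * s) < 0 := log_neg g1 (by nlinarith)
  have l2 : log (1 - (a + b) * s) < 0 := log_neg g2 (by nlinarith)
  have l3 : log (1 - s) = log (1 - (a + c) * s) + log (1 - (a + b) * s) := by
    rw [e3, log_mul g1.ne' g2.ne']
  have hs1 : s < 1 := by have := mul_pos g1 g2; linarith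
  -- Tangency at `s` forces this value for `U`. By independence the logarithms add up (`l3`), so the
  -- value forced for `V` is exactly `1 - η`.
  set η := log (1 - (a + c) * s) / log (1 - s) with hη
  have hl : log (1 - s) < 0 := by linarith
  have hη0 : 0 ≤ η := div_nonneg_of_nonpos l1.le hl.le
  have hη1 : η ≤ 1 := by rw [hη, div_le_one_of_neg hl]; linarith
  have hηU : log (1 - (a + c) * s) = η * log (1 - s) := (div_mul_cancel₀ _ hl.ne).symm
  have hηV : log (1 - (a + b) * s) = (1 - η) * log (1 - s) := by linarith
  -- The Z-channel: the output is `i` surely when `X = x₀`, and differs from `i` with probability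
  -- `d` otherwise. The dominating line vanishes at `x₀` and touches at `s`.
  have domi : ∀ (θ d : ℝ) (i : Bool), 0 < d → d < 1 → 0 ≤ θ → θ ≤ 1 →
      log (1 - d * s) = θ * log (1 - s) →
      Dominates θ (fun x u : Bool => if x = x₀ then (if u = i then 1 else 0)
        else (if u = i then 1 - d else d))
        (fun x => if x = x₀ then 0 else -((binEntropy (d * s) - θ * binEntropy s) / s)) := by
    intro θ d i d0 d1 θ0 θ1 hθ
    refine dominates_of_unit' (!x₀) (fun x => ?_) fun r hr => ?_
    · rw [sum_bool_eq i]; by_cases hx : x = x₀ <;> simp [hx]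
    · have := entropy_gap_ge_of_log_eq d0 d1 hs0 hs1 θ0 θ1 hθ hr
      simp only [sum_bool_eq i, Bool.not_not, Bool.not_eq_self, if_false, if_true, mul_zero,
        add_zero, mul_one, zero_mul]
      rw [binEntropy_eq_negMulLog_add_negMulLog_one_sub (d * r)] at this
      rw [show r * (1 - d) + (1 - r) = 1 - d * r by ring, mul_comm r d]
      linarith
  refine auxValue_le_of_dominates hW.1 hW.2 hW.3 hW.4 hw.nonneg_marginal hη0 hη1 ?_ ?_
    (domi η (a + c) u₀ ht (by linarith) hη0 hη1 hηU)
    (domi (1 - η) (a + b) v₀ hs (by linarith) (by linarith) (by linarith) hηV) ?_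
  · intro u x
    rw [sum_bool_eq v₀]
    rcases Bool.eq_or_eq_not x x₀ with rfl | rfl <;> rcases Bool.eq_or_eq_not u u₀ with rfl | rfl
    · simp [z3, hp0]
    · simp [z2, z4]
    · simp [z1, hwb]; left; linarith
    · simp [hwa, hwc]; ring
  · intro v x
    rw [sum_bool_eq u₀]
    rcases Bool.eq_or_eq_not x x₀ with rfl | rfl <;> rcases Bool.eq_or_eq_not v v₀ with rfl | rfl
    · simp [z2, hp0]
    · simp [z3, z4]
    · simp [z1, hwc]; left; linarith
    · simp [hwa, hwb]; ring
  · have key := entropy_of_independent_complement ha hb hc habc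
    rw [← hsdef, ← e1, ← e2] at key
    rw [sum_sum_bool_eq u₀ v₀]
    simp only [sum_bool_eq x₀, z1, z2, z3, z4, hwa, hwb, hwc, ← hp0,
      if_true, Bool.not_eq_self, if_false, add_zero, zero_add, zero_mul, negMulLog_mul]
    have k2 : -((binEntropy ((a + c) * s) - η * binEntropy s) / s)
        + -((binEntropy ((a + b) * s) - (1 - η) * binEntropy s) / s)
        = -(negMulLog a + negMulLog b + negMulLog c) := by
      rw [← key]; ring
    rw [k2]
    have k3 : (a + b + c) * negMulLog (p !x₀) = negMulLog (p !x₀) := by rw [habc, one_mul]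
    linarith

/-- The case of binary `U` and `V`. -/
lemma auxValue_le_of_binary (hW : IsChannelPair Wy Wz) {w : Bool → Bool → Bool → ℝ}
    {p : Bool → ℝ} (hw : IsJointLaw w p) {f : Bool → Bool → Bool}
    (h : ∀ u v x, x ≠ f u v → w u v x = 0) :
    auxValue Wy Wz w ≤ inputBound Wy Wz p := by
  by_cases hpos : ∀ x, 0 < p x
  swap
  · push Not at hpos
    obtain ⟨x, hx⟩ := hpos
    exact auxValue_le_of_eq_zero hW.2 hW.4 hw.1 hw.2 hw.3 (le_antisymm hx (hw.nonneg_marginal x))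
  have classify : ∀ f : Bool → Bool → Bool, (∃ c, ∀ u v, f u v = c) ∨
      (∃ k, ∀ u v, f u v = xor u k) ∨ (∃ k, ∀ u v, f u v = xor v k) ∨
      (∃ k, ∀ u v, f u v = xor (xor u v) k) ∨
      ∃ u₀ v₀ x₀, ∀ u v, (f u v = x₀ ↔ u = u₀ ∧ v = v₀) := by decide
  rcases classify f with ⟨c, hf⟩ | ⟨k, hf⟩ | ⟨k, hf⟩ | ⟨k, hf⟩ | ⟨u₀, v₀, x₀, hf⟩
  · have := hw.sum_eq (!c)
    simp [h _ _ (!c) (by simp [hf])] at this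
    exact absurd this (hpos _).ne
  · exact auxValue_le_of_eq_fst hW hw hpos (k := k) fun u v x hx => h u v x (by rwa [hf])
  · exact auxValue_le_of_eq_snd hW hw hpos (k := k) fun u v x hx => h u v x (by rwa [hf])
  · exact auxValue_le_of_eq_xor hW hw hpos (k := k) fun u v x hx => h u v x (by rwa [hf])
  have h' : ∀ u v x, ¬(x = x₀ ↔ u = u₀ ∧ v = v₀) → w u v x = 0 := fun u v x hx =>
    h u v x (by rintro rfl; exact hx (hf u v))
  -- If one of the three cells with `x = !x₀` has no mass, the conjunction agrees on the support
  -- with an exclusive or or with a projection.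
  have cellX : ∀ u₀ v₀ x₀ u v x : Bool, x ≠ xor (xor u v) (xor (xor u₀ v₀) x₀) →
      ¬(u = (!u₀) ∧ v = (!v₀) ∧ x = (!x₀)) → ¬(x = x₀ ↔ u = u₀ ∧ v = v₀) := by decide
  have cellU : ∀ u₀ v₀ x₀ u v x : Bool, x ≠ xor u (xor u₀ x₀) →
      ¬(u = u₀ ∧ v = (!v₀) ∧ x = (!x₀)) → ¬(x = x₀ ↔ u = u₀ ∧ v = v₀) := by decide
  have cellV : ∀ u₀ v₀ x₀ u v x : Bool, x ≠ xor v (xor v₀ x₀) →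
      ¬(u = (!u₀) ∧ v = v₀ ∧ x = (!x₀)) → ¬(x = x₀ ↔ u = u₀ ∧ v = v₀) := by decide
  rcases (hw.nonneg (!u₀) (!v₀) (!x₀)).eq_or_lt with ha | ha
  · refine auxValue_le_of_eq_xor hW hw hpos (k := xor (xor u₀ v₀) x₀) fun u v x hx => ?_
    by_cases hcell : u = (!u₀) ∧ v = (!v₀) ∧ x = (!x₀)
    · rw [hcell.1, hcell.2.1, hcell.2.2, ha]
    · exact h' u v x (cellX _ _ _ _ _ _ hx hcell)
  rcases (hw.nonneg u₀ (!v₀) (!x₀)).eq_or_lt with hb | hb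
  · refine auxValue_le_of_eq_fst hW hw hpos (k := xor u₀ x₀) fun u v x hx => ?_
    by_cases hcell : u = u₀ ∧ v = (!v₀) ∧ x = (!x₀)
    · rw [hcell.1, hcell.2.1, hcell.2.2, hb]
    · exact h' u v x (cellU _ _ _ _ _ _ hx hcell)
  rcases (hw.nonneg (!u₀) v₀ (!x₀)).eq_or_lt with hc | hc
  · refine auxValue_le_of_eq_snd hW hw hpos (k := xor v₀ x₀) fun u v x hx => ?_
    by_cases hcell : u = (!u₀) ∧ v = v₀ ∧ x = (!x₀)
    · rw [hcell.1, hcell.2.1, hcell.2.2, hc]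
    · exact h' u v x (cellV _ _ _ _ _ _ hx hcell)
  exact auxValue_le_of_eq_and hW hw hpos h' ha hb hc

end Binary

/-! ### Reducing the support of a weight vector -/

section Support
variable {ι : Type*}

/-- The ratio test of linear programming: `t` is the least `c i / -L i` over the indices with `L i <
0`. -/
lemma exists_boundary_of_neg {s : Finset ι} {c L : ι → ℝ} (hc : ∀ i ∈ s, 0 < c i)
    (hc' : ∀ i ∉ s, c i = 0) (hL' : ∀ i ∉ s, L i = 0) (hneg : ∃ i ∈ s, L i < 0) :
    ∃ t, 0 < t ∧ (∀ i, 0 ≤ c i + t * L i) ∧ ∃ i ∈ s, c i + t * L i = 0 := by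
  classical
  obtain ⟨j, hj, hmin⟩ := Finset.exists_min_image (s.filter fun i => L i < 0)
    (fun i => c i / -L i) (by obtain ⟨i, hi, h⟩ := hneg; exact ⟨i, by simp [hi, h]⟩)
  rw [mem_filter] at hj
  have hjL : 0 < -L j := by linarith [hj.2]
  have ht : 0 < c j / -L j := div_pos (hc j hj.1) hjL
  refine ⟨c j / -L j, ht, fun i => ?_, j, hj.1, ?_⟩
  · by_cases hi : i ∈ s
    · by_cases hLi : L i < 0
      · have := hmin i (by simp [hi, hLi])
        rw [le_div_iff₀ (by linarith)] at this
        linarith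
      · have := mul_nonneg ht.le (not_lt.1 hLi)
        linarith [hc i hi]
    · simp [hc' i hi, hL' i hi]
  · have : L j ≠ 0 := hj.2.ne
    field_simp
    ring

/-- More than two vectors in the plane are dependent. Summing the relation over both coordinates
gives positive masses weighted by `L` with total zero, so `L` takes both signs. -/
lemma exists_pos_neg_relation {s : Finset ι} {M : ι → Bool → ℝ}
    (hM : ∀ i ∈ s, 0 < ∑ x, M i x) (hs : 2 < s.card) :
    ∃ L : ι → ℝ, (∀ i ∉ s, L i = 0) ∧ (∀ x, ∑ i ∈ s, L i * M i x = 0) ∧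
      (∃ i ∈ s, L i < 0) ∧ ∃ i ∈ s, 0 < L i := by
  classical
  have hdep : ¬ LinearIndependent ℝ (fun i : s => M i) := fun h => by
    have := h.fintype_card_le_finrank
    simp at this
    omega
  obtain ⟨g, hg, i₀, hi₀⟩ := Fintype.not_linearIndependent_iff.1 hdep
  set L : ι → ℝ := fun i => if h : i ∈ s then g ⟨i, h⟩ else 0 with hL
  have hLg : ∀ i : s, L i = g i := fun i => by simp [hL]
  have hrel : ∀ x, ∑ i ∈ s, L i * M i x = 0 := fun x => by
    have := congrFun hg x
    rw [Finset.sum_apply] at this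
    rw [← Finset.sum_coe_sort]
    simpa [hLg] using this
  have htot : ∑ i ∈ s, L i * ∑ x, M i x = 0 := by
    simp_rw [Finset.mul_sum]
    rw [Finset.sum_comm]
    exact Finset.sum_eq_zero fun x _ => hrel x
  have hne : L i₀ ≠ 0 := by rw [hLg]; exact hi₀
  refine ⟨L, fun i hi => by simp [hL, hi], hrel, ?_, ?_⟩ <;> by_contra! hcon
  · have := (Finset.sum_eq_zero_iff_of_nonneg fun i hi =>
      mul_nonneg (hcon i hi) (hM i hi).le).1 htot i₀ i₀.2
    exact hne ((mul_eq_zero.1 this).resolve_right (hM _ i₀.2).ne')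
  · have := (Finset.sum_eq_zero_iff_of_nonpos fun i hi =>
      mul_nonpos_of_nonpos_of_nonneg (hcon i hi) (hM i hi).le).1 htot i₀ i₀.2
    exact hne ((mul_eq_zero.1 this).resolve_right (hM _ i₀.2).ne')

/-- A convex function of nonnegative weights does not decrease under a suitable change of the
weights that preserves two given moments and leaves at most two of them nonzero. -/
lemma exists_weights_card_le_two [Fintype ι] {M : ι → Bool → ℝ} {f : (ι → ℝ) → ℝ}
    (hf : ConvexOn ℝ {c : ι → ℝ | ∀ i, 0 ≤ c i} f) (s : Finset ι) :
    (∀ i ∈ s, 0 < ∑ x, M i x) → ∀ c : ι → ℝ, (∀ i, 0 ≤ c i) → (∀ i ∉ s, c i = 0) →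
    ∃ c' : ι → ℝ, (∀ i, 0 ≤ c' i) ∧ (∀ x, ∑ i, c' i * M i x = ∑ i, c i * M i x) ∧ f c ≤ f c' ∧
      ∃ t : Finset ι, t.card ≤ 2 ∧ ∀ i ∉ t, c' i = 0 := by
  classical
  induction s using Finset.strongInduction with
  | H s ih =>
  intro hM c hc hcs
  rcases le_or_gt s.card 2 with hcard | hcard
  · exact ⟨c, hc, fun _ => rfl, le_rfl, s, hcard, hcs⟩
  have step : ∀ c₁ : ι → ℝ, (∀ i, 0 ≤ c₁ i) → (∀ i ∉ s, c₁ i = 0) → (∃ i ∈ s, c₁ i = 0) →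
      ∃ c' : ι → ℝ, (∀ i, 0 ≤ c' i) ∧ (∀ x, ∑ i, c' i * M i x = ∑ i, c₁ i * M i x) ∧
        f c₁ ≤ f c' ∧ ∃ t : Finset ι, t.card ≤ 2 ∧ ∀ i ∉ t, c' i = 0 := by
    rintro c₁ h1 h2 ⟨i, hi, hi0⟩
    refine ih _ (Finset.erase_ssubset hi) (fun j hj => hM j (Finset.mem_of_mem_erase hj)) c₁ h1
      fun j hj => ?_
    by_cases hji : j = i
    · rw [hji, hi0]
    · exact h2 j fun hjs => hj (Finset.mem_erase.2 ⟨hji, hjs⟩)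
  by_cases hzero : ∃ i ∈ s, c i = 0
  · exact step c hc hcs hzero
  push Not at hzero
  have hpos : ∀ i ∈ s, 0 < c i := fun i hi => lt_of_le_of_ne (hc i) (hzero i hi).symm
  obtain ⟨L, hL0, hrel, hneg, hposL⟩ := exists_pos_neg_relation hM hcard
  have hrel' : ∀ x, ∑ i, L i * M i x = 0 := fun x => by
    rw [← hrel x]
    exact (Finset.sum_subset (Finset.subset_univ s) fun i _ hi => by rw [hL0 i hi, zero_mul]).symm
  obtain ⟨t₁, ht₁, hn₁, hz₁⟩ := exists_boundary_of_neg hpos hcs hL0 hneg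
  obtain ⟨t₂, ht₂, hn₂, hz₂⟩ := exists_boundary_of_neg (L := fun i => -L i) hpos hcs
    (fun i hi => by simp [hL0 i hi]) (by obtain ⟨i, hi, h⟩ := hposL; exact ⟨i, hi, by linarith⟩)
  have hmom : ∀ (t : ℝ) x, ∑ i, (c i + t * L i) * M i x = ∑ i, c i * M i x := fun t x => by
    simp only [add_mul, Finset.sum_add_distrib, mul_assoc, ← Finset.mul_sum, hrel', mul_zero,
      add_zero]
  -- The point `c` lies between the two boundary points reached along `L` and `-L`, so one of them
  -- has a value at least as large.
  have hmax : f c ≤ max (f fun i => c i + t₁ * L i) (f fun i => c i + t₂ * -L i) := by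
    refine hf.le_max_of_mem_segment hn₁ hn₂ ⟨t₂ / (t₁ + t₂), t₁ / (t₁ + t₂), by positivity,
      by positivity, by field_simp; ring, ?_⟩
    funext i
    simp only [Pi.add_apply, Pi.smul_apply, smul_eq_mul]
    field_simp
    ring
  rcases le_max_iff.1 hmax with h | h
  · obtain ⟨c', h1, h2, h3, h4⟩ := step _ hn₁ (fun i hi => by simp [hcs i hi, hL0 i hi]) hz₁
    exact ⟨c', h1, fun x => (h2 x).trans (hmom t₁ x), h.trans h3, h4⟩
  · obtain ⟨c', h1, h2, h3, h4⟩ := step _ hn₂ (fun i hi => by simp [hcs i hi, hL0 i hi]) hz₂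
    refine ⟨c', h1, fun x => (h2 x).trans ?_, h.trans h3, h4⟩
    rw [← hmom (-t₂) x]
    exact Finset.sum_congr rfl fun i _ => by ring

/-- The map `e` need not be injective: missing indices are filled by a repeated one with weight `0`,
which is harmless because `g i 0 = 0`. -/
lemma exists_bool_reindex [Fintype ι] [Nonempty ι] {c : ι → ℝ} (hc : ∀ i, 0 ≤ c i)
    {t : Finset ι} (ht : t.card ≤ 2) (hct : ∀ i ∉ t, c i = 0) :
    ∃ (e : Bool → ι) (d : Bool → ℝ), (∀ b, 0 ≤ d b) ∧
      ∀ g : ι → ℝ → ℝ, (∀ i, g i 0 = 0) → ∑ i, g i (c i) = ∑ b, g (e b) (d b) := by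
  classical
  have hsum : ∀ g : ι → ℝ → ℝ, (∀ i, g i 0 = 0) → ∑ i, g i (c i) = ∑ i ∈ t, g i (c i) :=
    fun g hg => (Finset.sum_subset (Finset.subset_univ t) fun i _ hi => by rw [hct i hi, hg]).symm
  interval_cases h : t.card
  · rw [Finset.card_eq_zero] at h
    refine ⟨fun _ => Classical.arbitrary ι, fun _ => 0, fun _ => le_rfl, fun g hg => ?_⟩
    rw [hsum g hg, h]; simp [hg]
  · obtain ⟨i, rfl⟩ := Finset.card_eq_one.1 h
    refine ⟨fun _ => i, fun b => if b then c i else 0, fun b => ?_, fun g hg => ?_⟩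
    · dsimp only; split_ifs; exacts [hc i, le_rfl]
    · rw [hsum g hg]; simp [hg]
  · obtain ⟨i, j, hij, rfl⟩ := Finset.card_eq_two.1 h
    refine ⟨fun b => if b then i else j, fun b => if b then c i else c j, fun b => ?_,
      fun g hg => ?_⟩
    · dsimp only; split_ifs; exacts [hc i, hc j]
    · rw [hsum g hg, Finset.sum_pair hij]; simp

end Support

/-! ### Reduction to binary auxiliary variables -/

section Reduction
variable {U V Y Z : Type*} [Fintype U] [Fintype V] [Fintype Y] [Fintype Z]
  {Wy : Bool → Y → ℝ} {Wz : Bool → Z → ℝ}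

/-- The terms in `negMulLog (d b)` from `H(U,V)` and `H(U,Y)` cancel, both laws having the same mass
at each `b`. What remains is linear in `d` minus a concave function of `d`. -/
lemma auxValue_reweight {U B : Type*} [Fintype B] (hW : IsChannelPair Wy Wz) (w : U → V → Bool → ℝ)
    (e : B → U) (d : B → ℝ) :
    auxValue Wy Wz (fun b v x => d b * w (e b) v x)
      = (∑ b, d b * ((∑ v, negMulLog (∑ x, w (e b) v x))
          - ∑ y, negMulLog (∑ x, (∑ v, w (e b) v x) * Wy x y)))
        - ∑ v, ∑ z, negMulLog (∑ b, d b * ∑ x, w (e b) v x * Wz x z) := by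
  have h1 : ∀ u, ∑ y, ∑ x, (∑ v, w u v x) * Wy x y = ∑ v, ∑ x, w u v x := fun u => by
    rw [Finset.sum_comm]
    simp_rw [← Finset.mul_sum, hW.sum_fst, mul_one]
    rw [Finset.sum_comm]
  have h2 : ∀ v z, ∑ x, (∑ b, d b * w (e b) v x) * Wz x z
      = ∑ b, d b * ∑ x, w (e b) v x * Wz x z := fun v z => by
    simp_rw [Finset.sum_mul, Finset.mul_sum]
    rw [Finset.sum_comm]
    simp_rw [mul_assoc]
  unfold auxValue
  simp only [h2]
  simp only [← Finset.mul_sum, mul_assoc, negMulLog_mul, Finset.sum_add_distrib, ← Finset.sum_mul,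
    h1, mul_sub, Finset.sum_sub_distrib]
  ring

/-- `U` may be replaced by a binary variable without changing the law of `(V, X)` given it. -/
lemma exists_binary_fst [Nonempty U] (hW : IsChannelPair Wy Wz) {w : U → V → Bool → ℝ}
    {p : Bool → ℝ} (hw : IsJointLaw w p) :
    ∃ (e : Bool → U) (d : Bool → ℝ), IsJointLaw (fun b v x => d b * w (e b) v x) p ∧
      auxValue Wy Wz w ≤ auxValue Wy Wz (fun b v x => d b * w (e b) v x) := by
  classical
  set M : U → Bool → ℝ := fun u x => ∑ v, w u v x with hMdef
  have hM0 : ∀ u x, 0 ≤ M u x := fun u x => sum_nonneg fun v _ => hw.nonneg u v x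
  set κ : U → ℝ := fun u => (∑ v, negMulLog (∑ x, w u v x))
    - ∑ y, negMulLog (∑ x, (∑ v, w u v x) * Wy x y) with hκ
  set m : U → V → Z → ℝ := fun u v z => ∑ x, w u v x * Wz x z with hm
  have hm0 : ∀ u v z, 0 ≤ m u v z := fun u v z =>
    sum_nonneg fun x _ => mul_nonneg (hw.nonneg u v x) (hW.nonneg_snd x z)
  set f : (U → ℝ) → ℝ := fun c =>
    (∑ u, c u * κ u) - ∑ v, ∑ z, negMulLog (∑ u, c u * m u v z) with hf
  have hfconv : ConvexOn ℝ {c : U → ℝ | ∀ u, 0 ≤ c u} f := by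
    refine ⟨fun c hc c' hc' a b ha hb _ u => add_nonneg (mul_nonneg ha (hc u))
      (mul_nonneg hb (hc' u)), fun c hc c' hc' a b ha hb hab => ?_⟩
    have lin : ∀ k : U → ℝ, ∑ u, (a • c + b • c') u * k u
        = a * (∑ u, c u * k u) + b * ∑ u, c' u * k u := fun k => by
      simp only [Pi.add_apply, Pi.smul_apply, smul_eq_mul, add_mul, Finset.sum_add_distrib,
        Finset.mul_sum, mul_assoc]
    have hv : ∀ v z, a * negMulLog (∑ u, c u * m u v z) + b * negMulLog (∑ u, c' u * m u v z)
        ≤ negMulLog (a * (∑ u, c u * m u v z) + b * ∑ u, c' u * m u v z) := fun v z =>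
      concaveOn_negMulLog.2
        (show _ ∈ Set.Ici (0 : ℝ) from sum_nonneg fun u _ => mul_nonneg (hc u) (hm0 u v z))
        (show _ ∈ Set.Ici (0 : ℝ) from sum_nonneg fun u _ => mul_nonneg (hc' u) (hm0 u v z))
        ha hb hab
    have := Finset.sum_le_sum (s := Finset.univ) fun v _ =>
      Finset.sum_le_sum (s := Finset.univ) fun z _ => hv v z
    simp only [Finset.sum_add_distrib, ← Finset.mul_sum] at this
    simp only [hf, lin, smul_eq_mul]
    linarith
  -- The starting weights are the indicator of the values of positive mass, as the support lemma
  -- needs positive masses; the other values contribute nothing.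
  set s : Finset U := univ.filter fun u => 0 < ∑ x, M u x with hs
  have hnull : ∀ u ∉ s, ∀ v x, w u v x = 0 := fun u hu v x => by
    have h0 : ∑ x, M u x = 0 := by
      refine le_antisymm (not_lt.1 fun h => hu (mem_filter.2 ⟨mem_univ u, h⟩)) (sum_nonneg fun x _ => hM0 u x)
    have h1 := (Finset.sum_eq_zero_iff_of_nonneg fun x _ => hM0 u x).1 h0 x (mem_univ x)
    exact (Finset.sum_eq_zero_iff_of_nonneg fun v _ => hw.nonneg u v x).1 h1 v (mem_univ v)
  obtain ⟨c', hc', hmom, hle, t, ht, hct⟩ := exists_weights_card_le_two hfconv s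
    (M := M) (fun u hu => (mem_filter.1 hu).2) (fun u => if u ∈ s then 1 else 0)
    (fun u => by split_ifs <;> norm_num) (fun u hu => by simp [hu])
  obtain ⟨e, d, hd, hre⟩ := exists_bool_reindex hc' ht hct
  have hind : ∀ (k : U → ℝ), (∀ u ∉ s, k u = 0) →
      ∑ u, (if u ∈ s then (1 : ℝ) else 0) * k u = ∑ u, k u := fun k hk =>
    Finset.sum_congr rfl fun u _ => by
      split_ifs with hu
      · rw [one_mul]
      · rw [hk u hu, zero_mul]
  refine ⟨e, d, ⟨fun b v x => mul_nonneg (hd b) (hw.nonneg _ v x), fun x => ?_, hw.sum_eq_one⟩, ?_⟩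
  · have h1 := hre (fun u r => r * M u x) fun u => zero_mul _
    have h2 := hind (fun u => M u x) fun u hu => by simp [hMdef, hnull u hu]
    simp only [← Finset.mul_sum]
    rw [← h1, hmom x, h2, hMdef]
    exact hw.sum_eq x
  · have h1 := auxValue_reweight hW w id fun _ => (1 : ℝ)
    simp only [id, one_mul] at h1
    rw [auxValue_reweight hW w e d, h1]
    have h2 : f (fun u => if u ∈ s then 1 else 0)
        = (∑ u, κ u) - ∑ v, ∑ z, negMulLog (∑ u, m u v z) := by
      simp only [hf]
      rw [hind κ fun u hu => by simp [hκ, hnull u hu]]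
      simp only [fun v z => hind (fun u => m u v z) fun u hu => by simp [hm, hnull u hu]]
    have h3 : f c' = (∑ b, d b * κ (e b)) - ∑ v, ∑ z, negMulLog (∑ b, d b * m (e b) v z) := by
      simp only [hf]
      rw [hre (fun u r => r * κ u) fun u => zero_mul _]
      simp only [fun v z => hre (fun u r => r * m u v z) fun u => zero_mul _]
    rw [h2, h3] at hle
    exact hle

/-- The inequality when `X` is a function of `(U, V)`. -/
lemma auxValue_le_of_deterministic [Nonempty U] [Nonempty V] (hW : IsChannelPair Wy Wz)
    {w : U → V → Bool → ℝ} {p : Bool → ℝ} (hw : IsJointLaw w p) {f : U → V → Bool}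
    (h : ∀ u v x, x ≠ f u v → w u v x = 0) :
    auxValue Wy Wz w ≤ inputBound Wy Wz p := by
  obtain ⟨e, d, hw₁, h₁⟩ := exists_binary_fst hW hw
  obtain ⟨e', d', hw₂, h₂⟩ := exists_binary_fst hW.swap hw₁.swap
  rw [auxValue_swap Wy Wz (fun b v x => d b * w (e b) v x)] at h₂
  refine h₁.trans (h₂.trans ?_)
  rw [inputBound_swap Wz Wy]
  exact auxValue_le_of_binary hW.swap hw₂ (f := fun b b' => f (e b') (e' b)) fun b b' x hx => by
    rw [h _ _ _ hx, mul_zero, mul_zero]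

end Reduction

/-! ### Making `X` a function of the auxiliary variables -/

section Determinize

/-- A random function with independent values `F j` of law `θ j` has `θ i` as its marginal at `i`.
-/
lemma sum_prod_mul_indicator {ι : Type*} [Fintype ι] [DecidableEq ι] {θ : ι → Bool → ℝ}
    (hθ : ∀ i, ∑ x, θ i x = 1) (i : ι) (x : Bool) :
    ∑ F : ι → Bool, (∏ j, θ j (F j)) * (if F i = x then 1 else 0) = θ i x := by
  have h := Finset.prod_univ_sum (fun _ : ι => (univ : Finset Bool))
    (fun j b => θ j b * if j = i then (if b = x then 1 else 0) else 1)
  rw [Fintype.piFinset_univ] at h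
  calc ∑ F : ι → Bool, (∏ j, θ j (F j)) * (if F i = x then 1 else 0)
      = ∑ F : ι → Bool, ∏ j, (θ j (F j) * if j = i then (if F j = x then 1 else 0) else 1) := by
        refine Finset.sum_congr rfl fun F _ => ?_
        rw [Finset.prod_mul_distrib, Finset.prod_ite_eq' univ i, if_pos (mem_univ i)]
    _ = ∏ j, ∑ b, θ j b * (if j = i then (if b = x then 1 else 0) else 1) := h.symm
    _ = ∏ j, if j = i then θ i x else 1 := by
        refine Finset.prod_congr rfl fun j _ => ?_
        by_cases hj : j = i
        · subst hj; simp
        · simp only [if_neg hj, mul_one]; exact hθ j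
    _ = θ i x := by rw [Finset.prod_ite_eq' univ i, if_pos (mem_univ i)]

variable {U V Y Z : Type*} [Fintype U] [Fintype V] [Fintype Y] [Fintype Z]
  {Wy : Bool → Y → ℝ} {Wz : Bool → Z → ℝ}

lemma auxValue_le_inputBound (hW : IsChannelPair Wy Wz) [Nonempty U] [Nonempty V]
    {w : U → V → Bool → ℝ} {p : Bool → ℝ} (hw : IsJointLaw w p) :
    auxValue Wy Wz w ≤ inputBound Wy Wz p := by
  classical
  set P : U → V → ℝ := fun u v => ∑ x, w u v x with hP
  have hP0 : ∀ u v, 0 ≤ P u v := fun u v => sum_nonneg fun x _ => hw.nonneg u v x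
  obtain ⟨θ, hθ0, hθ1, hwθ⟩ : ∃ θ : U × V → Bool → ℝ, (∀ i x, 0 ≤ θ i x) ∧
      (∀ i, ∑ x, θ i x = 1) ∧ ∀ u v x, w u v x = P u v * θ (u, v) x := by
    -- Where `(u, v)` has no mass, any probability vector serves; the point mass at `true` is taken.
    refine ⟨fun i x => if P i.1 i.2 = 0 then (if x then 1 else 0) else w i.1 i.2 x / P i.1 i.2,
      fun i x => ?_, fun i => ?_, fun u v x => ?_⟩
    · dsimp only
      split_ifs
      exacts [zero_le_one, le_rfl, div_nonneg (hw.nonneg _ _ _) (hP0 _ _)]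
    · by_cases h : P i.1 i.2 = 0
      · simp [h]
      · simp only [if_neg h]
        rw [← Finset.sum_div]
        exact div_self h
    · by_cases h : P u v = 0
      · rw [h, zero_mul]
        exact (Finset.sum_eq_zero_iff_of_nonneg fun x _ => hw.nonneg u v x).1 h x (mem_univ x)
      · simp only [if_neg h]
        field_simp
  set lam : (U × V → Bool) → ℝ := fun F => ∏ j, θ j (F j) with hlam
  have hlam0 : ∀ F, 0 ≤ lam F := fun F => prod_nonneg fun j _ => hθ0 j _
  have hlamθ : ∀ i x, ∑ F, lam F * (if F i = x then 1 else 0) = θ i x :=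
    sum_prod_mul_indicator hθ1
  have hlam1 : ∑ F, lam F = 1 := by
    obtain ⟨u⟩ := ‹Nonempty U›
    obtain ⟨v⟩ := ‹Nonempty V›
    rw [← hθ1 (u, v)]
    simp_rw [← hlamθ]
    rw [Finset.sum_comm]
    simp
  set w' : U → V × (U × V → Bool) → Bool → ℝ := fun u q x =>
    lam q.2 * (P u q.1 * if q.2 (u, q.1) = x then 1 else 0) with hw'
  have hmarg : ∀ u v x, ∑ F, w' u (v, F) x = w u v x := fun u v x => by
    simp only [hw']
    rw [hwθ, ← hlamθ, Finset.mul_sum]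
    exact Finset.sum_congr rfl fun F _ => by ring
  have hmargU : ∀ u x, ∑ q, w' u q x = ∑ v, w u v x := fun u x => by
    rw [Fintype.sum_prod_type]
    exact Finset.sum_congr rfl fun v _ => hmarg u v x
  have hsumx : ∀ u q, ∑ x, w' u q x = lam q.2 * P u q.1 := fun u q => by
    simp only [hw', ← Finset.mul_sum]
    simp
  have hlaw : IsJointLaw w' p := by
    refine ⟨fun u q x => mul_nonneg (hlam0 _) (mul_nonneg (hP0 _ _) (by split_ifs <;> norm_num)),
      fun x => ?_, hw.sum_eq_one⟩
    simp only [hmargU]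
    exact hw.sum_eq x
  refine le_trans ?_ (auxValue_le_of_deterministic hW hlaw (f := fun u q => q.2 (u, q.1))
    fun u q x hx => by simp [hw', Ne.symm hx])
  set T : V → (U × V → Bool) → Z → ℝ := fun v F z =>
    ∑ x, (∑ u, P u v * if F (u, v) = x then 1 else 0) * Wz x z with hT
  have hT0 : ∀ v F z, 0 ≤ T v F z := fun v F z => sum_nonneg fun x _ =>
    mul_nonneg (sum_nonneg fun u _ => mul_nonneg (hP0 _ _) (by split_ifs <;> norm_num))
      (hW.nonneg_snd x z)
  have hTz : ∀ v F, ∑ z, T v F z = ∑ u, P u v := fun v F => by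
    simp only [hT]
    rw [Finset.sum_comm]
    simp_rw [← Finset.mul_sum, hW.sum_snd, mul_one]
    rw [Finset.sum_comm]
    simp
  have hTw : ∀ v F z, ∑ x, (∑ u, w' u (v, F) x) * Wz x z = lam F * T v F z := fun v F z => by
    simp only [hw', hT, ← Finset.mul_sum, mul_assoc]
  have hTsum : ∀ v z, ∑ F, lam F * T v F z = ∑ x, (∑ u, w u v x) * Wz x z := fun v z => by
    simp_rw [← hTw]
    rw [Finset.sum_comm]
    refine Finset.sum_congr rfl fun x _ => ?_
    rw [← Finset.sum_mul, Finset.sum_comm]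
    simp_rw [hmarg]
  -- Averaging over `F` recovers the law of `(V,Z)`, so concavity gives `H(V,Z|F) ≤ H(V,Z)`.
  have jensen : ∀ v z, ∑ F, lam F * negMulLog (T v F z)
      ≤ negMulLog (∑ x, (∑ u, w u v x) * Wz x z) := fun v z => by
    rw [← hTsum]
    exact concaveOn_negMulLog.le_map_sum (fun F _ => hlam0 F) hlam1 fun F _ => hT0 v F z
  have hVZ : ∑ q, ∑ z, negMulLog (∑ x, (∑ u, w' u q x) * Wz x z)
      ≤ (∑ v, ∑ u, P u v) * (∑ F, negMulLog (lam F))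
        + ∑ v, ∑ z, negMulLog (∑ x, (∑ u, w u v x) * Wz x z) := by
    rw [Fintype.sum_prod_type]
    simp only [hTw, negMulLog_mul, Finset.sum_add_distrib, ← Finset.sum_mul, hTz, ← Finset.mul_sum]
    have := Finset.sum_le_sum (s := Finset.univ) fun v _ =>
      Finset.sum_le_sum (s := Finset.univ) fun z _ => jensen v z
    have e : ∀ v, ∑ F, lam F * ∑ z, negMulLog (T v F z)
        = ∑ z, ∑ F, lam F * negMulLog (T v F z) := fun v => by
      simp_rw [Finset.mul_sum]
      rw [Finset.sum_comm]
    simp only [e]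
    linarith
  -- Here `F` is independent of `(U,V)`, so the entropy of `F` enters exactly; in `hVZ` it is an
  -- upper bound, with the same coefficient.
  have hUV : ∑ u, ∑ q, negMulLog (∑ x, w' u q x)
      = (∑ v, ∑ u, P u v) * (∑ F, negMulLog (lam F)) + ∑ u, ∑ v, negMulLog (∑ x, w u v x) := by
    simp only [hsumx, Fintype.sum_prod_type, negMulLog_mul, Finset.sum_add_distrib,
      ← Finset.mul_sum, ← Finset.sum_mul, hlam1, one_mul]
    rw [Finset.sum_comm]
  unfold auxValue
  simp only [hmargU, hUV]
  linarith

end Determinize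

/-! ### From random variables to finite sums -/

section Prob
set_option linter.unusedSectionVars false
variable {Ω A B C D E : Type*} [MeasurableSpace Ω] {μ : Measure Ω} [IsProbabilityMeasure μ]
  [Fintype A] [MeasurableSpace A] [MeasurableSingletonClass A]
  [Fintype B] [MeasurableSpace B] [MeasurableSingletonClass B]
  [Fintype C] [MeasurableSpace C] [MeasurableSingletonClass C]
  [Fintype D] [MeasurableSpace D] [MeasurableSingletonClass D]
  [Fintype E] [MeasurableSpace E] [MeasurableSingletonClass E]

lemma sum_real_inter_preimage (s : Set Ω) {X : Ω → A} (hX : Measurable X) :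
    ∑ a, μ.real (s ∩ X ⁻¹' {a}) = μ.real s := by
  have h := sum_measureReal_preimage_singleton (μ := μ.restrict s) (univ : Finset A) (f := X)
    fun a _ => hX (measurableSet_singleton a)
  rw [coe_univ, Set.preimage_univ, measureReal_restrict_apply_univ] at h
  rw [← h]
  refine Finset.sum_congr rfl fun a _ => ?_
  rw [measureReal_restrict_apply (hX (measurableSet_singleton a)), Set.inter_comm]

lemma prob_nonneg (X : Ω → A) (a : A) : 0 ≤ prob μ X a := measureReal_nonneg

lemma sum_prob {X : Ω → A} (hX : Measurable X) : ∑ a, prob μ X a = 1 := by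
  have := sum_real_inter_preimage (μ := μ) Set.univ hX
  simpa [prob] using this

lemma sum_prob_snd (X : Ω → A) {Y : Ω → B} (hY : Measurable Y) (a : A) :
    ∑ b, prob μ (fun ω => (X ω, Y ω)) (a, b) = prob μ X a := by
  rw [prob, ← sum_real_inter_preimage _ hY]
  refine Finset.sum_congr rfl fun b _ => congrArg μ.real ?_
  ext ω; simp

lemma prob_swap (X : Ω → A) (Y : Ω → B) (a : A) (b : B) :
    prob μ (fun ω => (X ω, Y ω)) (a, b) = prob μ (fun ω => (Y ω, X ω)) (b, a) := by
  refine congrArg μ.real ?_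
  ext ω; simp [and_comm]

lemma sum_prob_fst {X : Ω → A} (hX : Measurable X) (Y : Ω → B) (b : B) :
    ∑ a, prob μ (fun ω => (X ω, Y ω)) (a, b) = prob μ Y b := by
  simp_rw [prob_swap X Y]
  exact sum_prob_snd Y hX b

lemma sum_prob_mid (X : Ω → A) {Y : Ω → B} (hY : Measurable Y) (Z : Ω → C) (a : A) (c : C) :
    ∑ b, prob μ (fun ω => (X ω, Y ω, Z ω)) (a, b, c) = prob μ (fun ω => (X ω, Z ω)) (a, c) := by
  rw [prob, ← sum_real_inter_preimage _ hY]
  refine Finset.sum_congr rfl fun b _ => congrArg μ.real ?_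
  ext ω; simp; tauto

lemma prob_eq_zero_of_snd {X : Ω → A} (hX : Measurable X) {Y : Ω → B} {b : B}
    (h : prob μ Y b = 0) (a : A) : prob μ (fun ω => (X ω, Y ω)) (a, b) = 0 := by
  rw [← sum_prob_fst hX] at h
  exact (Finset.sum_eq_zero_iff_of_nonneg fun a _ => prob_nonneg _ _).1 h a (mem_univ a)

lemma prob_eq_zero_of_fst (X : Ω → A) {Y : Ω → B} (hY : Measurable Y) {a : A}
    (h : prob μ X a = 0) (b : B) : prob μ (fun ω => (X ω, Y ω)) (a, b) = 0 := by
  rw [prob_swap]; exact prob_eq_zero_of_snd hY h b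

lemma mutualInfo_eq {X : Ω → A} {Y : Ω → B} (hX : Measurable X) (hY : Measurable Y) :
    mutualInfo μ X Y = (∑ a, negMulLog (prob μ X a)) + (∑ b, negMulLog (prob μ Y b))
      - ∑ a, ∑ b, negMulLog (prob μ (fun ω => (X ω, Y ω)) (a, b)) := by
  have key : ∀ a b, prob μ (fun ω => (X ω, Y ω)) (a, b) *
      log (prob μ (fun ω => (X ω, Y ω)) (a, b) / (prob μ X a * prob μ Y b))
      = -negMulLog (prob μ (fun ω => (X ω, Y ω)) (a, b))
        - prob μ (fun ω => (X ω, Y ω)) (a, b) * log (prob μ X a)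
        - prob μ (fun ω => (X ω, Y ω)) (a, b) * log (prob μ Y b) := by
    intro a b
    by_cases h : prob μ (fun ω => (X ω, Y ω)) (a, b) = 0
    · simp [h]
    have ha : prob μ X a ≠ 0 := fun h' => h (prob_eq_zero_of_fst X hY h' b)
    have hb : prob μ Y b ≠ 0 := fun h' => h (prob_eq_zero_of_snd hX h' a)
    rw [log_div h (mul_ne_zero ha hb), log_mul ha hb, negMulLog]
    ring
  unfold mutualInfo
  simp only [key, Finset.sum_sub_distrib, Finset.sum_neg_distrib]
  rw [Finset.sum_comm (f := fun a b => prob μ (fun ω => (X ω, Y ω)) (a, b) * log (prob μ Y b))]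
  simp only [← Finset.sum_mul, sum_prob_snd X hY, sum_prob_fst hX Y, negMulLog, neg_mul,
    Finset.sum_neg_distrib]
  ring

lemma IsMarkovChain.fst {S₁ : Ω → A} {S₂ : Ω → B} {X : Ω → C} {T₁ : Ω → D} {T₂ : Ω → E}
    (hS₂ : Measurable S₂) (hT₂ : Measurable T₂)
    (h : IsMarkovChain μ (fun ω => (S₁ ω, S₂ ω)) X (fun ω => (T₁ ω, T₂ ω))) :
    IsMarkovChain μ S₁ X T₁ := by
  intro s x t
  have e1 : prob μ (fun ω => (S₁ ω, X ω, T₁ ω)) (s, x, t)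
      = ∑ b, ∑ c, prob μ (fun ω => ((S₁ ω, S₂ ω), X ω, (T₁ ω, T₂ ω))) ((s, b), x, (t, c)) := by
    rw [prob, ← sum_real_inter_preimage _ hS₂]
    refine Finset.sum_congr rfl fun b _ => ?_
    rw [← sum_real_inter_preimage _ hT₂]
    refine Finset.sum_congr rfl fun c _ => congrArg μ.real ?_
    ext ω; simp; tauto
  have e2 : prob μ (fun ω => (S₁ ω, X ω)) (s, x)
      = ∑ b, prob μ (fun ω => ((S₁ ω, S₂ ω), X ω)) ((s, b), x) := by
    rw [prob, ← sum_real_inter_preimage _ hS₂]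
    refine Finset.sum_congr rfl fun b _ => congrArg μ.real ?_
    ext ω; simp; tauto
  have e3 : prob μ (fun ω => (X ω, T₁ ω)) (x, t)
      = ∑ c, prob μ (fun ω => (X ω, (T₁ ω, T₂ ω))) (x, (t, c)) := by
    rw [prob, ← sum_real_inter_preimage _ hT₂]
    refine Finset.sum_congr rfl fun c _ => congrArg μ.real ?_
    ext ω; simp; tauto
  rw [e1, e2, e3, Finset.sum_mul_sum, Finset.sum_mul]
  refine Finset.sum_congr rfl fun b _ => ?_
  rw [Finset.sum_mul]
  exact Finset.sum_congr rfl fun c _ => h (s, b) x (t, c)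

lemma IsMarkovChain.snd {S₁ : Ω → A} {S₂ : Ω → B} {X : Ω → C} {T₁ : Ω → D} {T₂ : Ω → E}
    (hS₁ : Measurable S₁) (hT₁ : Measurable T₁)
    (h : IsMarkovChain μ (fun ω => (S₁ ω, S₂ ω)) X (fun ω => (T₁ ω, T₂ ω))) :
    IsMarkovChain μ S₂ X T₂ := by
  refine IsMarkovChain.fst hS₁ hT₁ fun s x t => ?_
  have := h (s.2, s.1) x (t.2, t.1)
  refine Eq.trans ?_ (this.trans ?_)
  · refine congrArg (· * _) (congrArg μ.real ?_)
    ext ω; simp [Prod.ext_iff]; tauto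
  · refine congrArg₂ (· * ·) (congrArg μ.real ?_) (congrArg μ.real ?_) <;>
      (ext ω; simp [Prod.ext_iff]; tauto)

/-- The conditional law of `Y` given `X = x`; the law of `Y` if `P(X = x) = 0`. -/
noncomputable def condLaw (μ : Measure Ω) (X : Ω → A) (Y : Ω → B) (x : A) (y : B) : ℝ :=
  if prob μ X x = 0 then prob μ Y y else prob μ (fun ω => (X ω, Y ω)) (x, y) / prob μ X x

lemma condLaw_nonneg (X : Ω → A) (Y : Ω → B) (x : A) (y : B) : 0 ≤ condLaw μ X Y x y := by
  unfold condLaw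
  split_ifs
  exacts [prob_nonneg _ _, div_nonneg (prob_nonneg _ _) (prob_nonneg _ _)]

lemma sum_condLaw (X : Ω → A) {Y : Ω → B} (hY : Measurable Y) (x : A) :
    ∑ y, condLaw μ X Y x y = 1 := by
  by_cases h : prob μ X x = 0
  · simp only [condLaw, if_pos h]; exact sum_prob hY
  · simp only [condLaw, if_neg h]
    rw [← Finset.sum_div, sum_prob_snd X hY, div_self h]

lemma prob_mul_condLaw (X : Ω → A) {Y : Ω → B} (hY : Measurable Y) (x : A) (y : B) :
    prob μ X x * condLaw μ X Y x y = prob μ (fun ω => (X ω, Y ω)) (x, y) := by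
  by_cases h : prob μ X x = 0
  · rw [h, zero_mul, prob_eq_zero_of_fst X hY h]
  · rw [condLaw, if_neg h, mul_div_cancel₀ _ h]

/-- The Markov property allows the law of `Y` given `X` to replace that given `(U,X)`; values of `X`
of probability zero contribute nothing on either side. -/
lemma IsMarkovChain.sum_mul_condLaw {U : Ω → A} {X : Ω → B} {Y : Ω → C} (hU : Measurable U)
    (hX : Measurable X) (h : IsMarkovChain μ U X Y) (u : A) (y : C) :
    ∑ x, prob μ (fun ω => (U ω, X ω)) (u, x) * condLaw μ X Y x y
      = prob μ (fun ω => (U ω, Y ω)) (u, y) := by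
  rw [← sum_prob_mid U hX Y]
  refine Finset.sum_congr rfl fun x _ => ?_
  by_cases hx : prob μ X x = 0
  · rw [prob_eq_zero_of_snd hU hx, zero_mul]
    refine le_antisymm measureReal_nonneg (hx ▸ measureReal_mono fun ω hω => ?_)
    simp only [Set.mem_preimage, Set.mem_singleton_iff, Prod.mk.injEq] at hω ⊢
    exact hω.2.1
  · rw [condLaw, if_neg hx, ← mul_div_assoc, ← h u x y, mul_div_cancel_right₀ _ hx]

end Prob

end InfoIneq

/-! ### Transfer to the original random variables -/

theorem theorem1 {Ω 𝒰 𝒱 𝒳 𝒴 𝒵 : Type*}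
    [MeasurableSpace Ω] (μ : Measure Ω) [IsProbabilityMeasure μ]
    [Fintype 𝒰] [MeasurableSpace 𝒰] [MeasurableSingletonClass 𝒰]
    [Fintype 𝒱] [MeasurableSpace 𝒱] [MeasurableSingletonClass 𝒱]
    [Fintype 𝒳] [MeasurableSpace 𝒳] [MeasurableSingletonClass 𝒳]
    [Fintype 𝒴] [MeasurableSpace 𝒴] [MeasurableSingletonClass 𝒴]
    [Fintype 𝒵] [MeasurableSpace 𝒵] [MeasurableSingletonClass 𝒵]
    (U : Ω → 𝒰) (V : Ω → 𝒱) (X : Ω → 𝒳) (Y : Ω → 𝒴) (Z : Ω → 𝒵)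
    (hU : Measurable U) (hV : Measurable V) (hX : Measurable X)
    (hY : Measurable Y) (hZ : Measurable Z)
    (hmarkov : InfoIneq.IsMarkovChain μ (fun ω => (U ω, V ω)) X (fun ω => (Y ω, Z ω)))
    (hcard : Fintype.card 𝒳 = 2) :
    InfoIneq.mutualInfo μ U Y + InfoIneq.mutualInfo μ V Z - InfoIneq.mutualInfo μ U V ≤
      max (InfoIneq.mutualInfo μ X Y) (InfoIneq.mutualInfo μ X Z) := by
  open InfoIneq Real in
  obtain ⟨ω₀⟩ := nonempty_of_isProbabilityMeasure μ
  have : Nonempty 𝒰 := ⟨U ω₀⟩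
  have : Nonempty 𝒱 := ⟨V ω₀⟩
  let e : Bool ≃ 𝒳 := Fintype.equivOfCardEq (by rw [hcard]; rfl)
  have hW : IsChannelPair (fun b y => condLaw μ X Y (e b) y) (fun b z => condLaw μ X Z (e b) z) :=
    ⟨fun b y => condLaw_nonneg X Y _ y, fun b => sum_condLaw X hY _,
      fun b z => condLaw_nonneg X Z _ z, fun b => sum_condLaw X hZ _⟩
  set w : 𝒰 → 𝒱 → Bool → ℝ := fun u v b => prob μ (fun ω => (U ω, V ω, X ω)) (u, v, e b) with hw
  have hwv : ∀ u b, ∑ v, w u v b = prob μ (fun ω => (U ω, X ω)) (u, e b) := fun u b =>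
    sum_prob_mid U hV X u (e b)
  have hwu : ∀ v b, ∑ u, w u v b = prob μ (fun ω => (V ω, X ω)) (v, e b) := fun v b =>
    sum_prob_fst hU (fun ω => (V ω, X ω)) (v, e b)
  have hwx : ∀ u v, ∑ b, w u v b = prob μ (fun ω => (U ω, V ω)) (u, v) := fun u v => by
    rw [← sum_prob_mid U hX V, ← e.sum_comp]
    refine Finset.sum_congr rfl fun b _ => congrArg μ.real ?_
    ext ω; simp; tauto
  have hlaw : IsJointLaw w fun b => prob μ X (e b) := by
    refine ⟨fun u v b => prob_nonneg _ _, fun b => ?_, ?_⟩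
    · simp only [hwv]; exact sum_prob_fst hU X (e b)
    · rw [e.sum_comp fun x => prob μ X x]; exact sum_prob hX
  have key := auxValue_le_inputBound hW hlaw
  unfold auxValue inputBound at key
  simp only [hwv, hwu, hwx, prob_mul_condLaw X hY, prob_mul_condLaw X hZ] at key
  have hUY : ∀ u y, ∑ b, prob μ (fun ω => (U ω, X ω)) (u, e b) * condLaw μ X Y (e b) y
      = prob μ (fun ω => (U ω, Y ω)) (u, y) := fun u y => by
    rw [e.sum_comp fun x => prob μ (fun ω => (U ω, X ω)) (u, x) * condLaw μ X Y x y]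
    exact (hmarkov.fst hV hZ).sum_mul_condLaw hU hX u y
  have hVZ : ∀ v z, ∑ b, prob μ (fun ω => (V ω, X ω)) (v, e b) * condLaw μ X Z (e b) z
      = prob μ (fun ω => (V ω, Z ω)) (v, z) := fun v z => by
    rw [e.sum_comp fun x => prob μ (fun ω => (V ω, X ω)) (v, x) * condLaw μ X Z x z]
    exact (hmarkov.snd hU hY).sum_mul_condLaw hV hX v z
  have hYm : ∀ y, ∑ b, prob μ (fun ω => (X ω, Y ω)) (e b, y) = prob μ Y y := fun y => by
    rw [e.sum_comp fun x => prob μ (fun ω => (X ω, Y ω)) (x, y)]; exact sum_prob_fst hX Y y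
  have hZm : ∀ z, ∑ b, prob μ (fun ω => (X ω, Z ω)) (e b, z) = prob μ Z z := fun z => by
    rw [e.sum_comp fun x => prob μ (fun ω => (X ω, Z ω)) (x, z)]; exact sum_prob_fst hX Z z
  simp only [hUY, hVZ, hYm, hZm] at key
  rw [e.sum_comp fun x => negMulLog (prob μ X x),
    e.sum_comp fun x => ∑ y, negMulLog (prob μ (fun ω => (X ω, Y ω)) (x, y)),
    e.sum_comp fun x => ∑ z, negMulLog (prob μ (fun ω => (X ω, Z ω)) (x, z))] at key
  rw [mutualInfo_eq hU hY, mutualInfo_eq hV hZ, mutualInfo_eq hU hV, mutualInfo_eq hX hY,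
    mutualInfo_eq hX hZ]
  rcases le_max_iff.1 key with h | h
  · exact le_max_of_le_left (by linarith)
  · exact le_max_of_le_right (by linarith)
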